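/- Let $\mathcal B$ be the set of power series $1+\sum_{n\ge 1}a_nx^n$ with all $a_n\in\{-1,0,1\}$, and define the connectedness loci $$\mathcal M=\{z\in\mathbb C:\ |z|<1,\ \exists f\in\mathcal B,\ f(z)=0\},$$ $$\mathcal N=\{(\gamma,\lambda)\in(-1,1)^2:\ \exists f\in\mathcal B,\ f(\gamma)=f(\lambda)=0\}.$$ For $F\subset\mathbb R$ put $\mathrm{Diag}(F)=\{(x,x):x\in F\}$. Let the antenna $\Gamma(\mathcal M)$ be the connected component of $[\tfrac12,1)\setminus\mathrm{clos}(\mathcal M\setminus\mathbb R)$ containing $\tfrac12$ (closure in $\mathbb C$), and let the antenna $\Gamma(\mathcal N)$ be the connected component of $\mathrm{Diag}([\tfrac12,1))\setminus\mathrm{clos}(\mathcal N\setminus\mathrm{Diag}(\mathbb R))$ containing $(\tfrac12,\tfrac12)$ (closure in $\mathbb R^2$). Then, identifying $\mathrm{Diag}(\mathbb R)$ with $\mathbb R$ through $(x,x)\mapsto x$, the tips of the antennas satisfy $$\sup\Gamma(\mathcal M)\in(0.6684755,\,0.6684757)\quad\text{and}\quad \sup\Gamma(\mathcal N)\in(0.6684755,\,0.6684757).$$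 -/

import Mathlib

open Set

noncomputable section

namespace ConnLoci

/-- Coefficient sequences of the class `ℬ` of power series `1 + ∑_{n ≥ 1} a n * x ^ n`
with all `a n ∈ {-1, 0, 1}`. -/
def classB : Set (ℕ → ℤ) :=
  {a | a 0 = 1 ∧ ∀ n, 1 ≤ n → a n ∈ ({-1, 0, 1} : Set ℤ)}

/-- The sum of the power series with coefficients `a` at the point `z`. For `a ∈ classB` and
`‖z‖ < 1`, the only case in which it is used below, the series converges absolutely. -/
def seriesSum {𝕜 : Type*} [RCLike 𝕜] (a : ℕ → ℤ) (z : 𝕜) : 𝕜 :=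
  ∑' n, (a n : 𝕜) * z ^ n

/-- The connectedness locus `𝓜` (Mandelbrot set for pairs of linear maps). -/
def locusM : Set ℂ :=
  {z | ‖z‖ < 1 ∧ ∃ a ∈ classB, seriesSum a z = 0}

/-- The connectedness locus `𝓝`. -/
def locusN : Set (ℝ × ℝ) :=
  {p | p.1 ∈ Ioo (-1 : ℝ) 1 ∧ p.2 ∈ Ioo (-1 : ℝ) 1 ∧
    ∃ a ∈ classB, seriesSum a p.1 = 0 ∧ seriesSum a p.2 = 0}

/-- The copy in `ℂ` of a set of reals. -/
def inComplex (F : Set ℝ) : Set ℂ := (fun x : ℝ => (x : ℂ)) '' F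

/-- `Diag F = {(x, x) : x ∈ F}`. -/
def Diag (F : Set ℝ) : Set (ℝ × ℝ) := (fun x : ℝ => (x, x)) '' F

/-- The antenna of `𝓜`: the connected component containing `1/2` of
`[1/2, 1) \ clos (𝓜 \ ℝ)`. -/
def antennaM : Set ℂ :=
  connectedComponentIn
    (inComplex (Ico (1 / 2 : ℝ) 1) \ closure (locusM \ inComplex univ)) (1 / 2)

/-- The antenna of `𝓝`: the connected component containing `(1/2, 1/2)` of
`Diag [1/2, 1) \ clos (𝓝 \ Diag ℝ)`. -/
def antennaN : Set (ℝ × ℝ) :=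
  connectedComponentIn
    (Diag (Ico (1 / 2 : ℝ) 1) \ closure (locusN \ Diag univ)) (1 / 2, 1 / 2)

end ConnLoci

end

open Set Filter Topology

namespace ConnLoci

/-! Both tips are controlled by double zeros of series in `ℬ`. A nonreal zero comes with its
conjugate and an off-diagonal point of `𝓝` is a pair of distinct zeros, so by compactness of `ℬ`
every `x` in `[1/2, 1)` in either closure is a double zero of some series
(`exists_double_zero_of_pairs`). Conversely, suppose `f ∈ ℬ` has a double zero at `x`, with `f = β
(y - x)² G` and `G x > 0`. For large `n`, adding `y ^ n` splits the zero into nonreal zeros near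
`x`, and subtracting `y ^ n` splits it into two real ones, so `x` lies in both closures
(`DoubleZero`).

Whether `x = β⁻¹` is a double zero is a question about a planar expanding system. The state of a
series is its value and Euler derivative at `x`, and removing a digit acts by `shiftState`. The
series starts with `1`, so a double zero means that the tail has state `(-β, β)`, and tails have
bounded orbits.

Lower bound: for `x ≤ 0.668475505` an interval search shows that every digit choice drives `(-β, β)`
out of the region of possible tail states (`no_double_zero`). Upper bound: at `x = 4188/6265` a
polygon, the trap, is covered by sets which nonempty digit words map into it. Any state that reaches
the trap thus has an infinite bounded orbit. The state `(-β, β)` reaches it, and the second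
coordinates along its orbit are the coefficients of `G` (`exists_doubleZero`). -/

/-! ### Integer interval search for escaping orbits -/

/-- Lower endpoint of the product of `[b₁, b₂]` (nonnegative) with an interval with left end `l`. -/
def mulLo (b₁ b₂ l : ℤ) : ℤ := if 0 ≤ l then b₁ * l else b₂ * l

/-- Upper endpoint of the product of `[b₁, b₂]` (nonnegative) with an interval with right end `h`. -/
def mulHi (b₁ b₂ h : ℤ) : ℤ := if 0 ≤ h then b₂ * h else b₁ * h

/-- The tree search. The box `[ul, uh] × [wl, wh]` is scaled by `s`, the expansion factor lies in
`[b₁, b₂] / 10 ^ 9`. The value `true` certifies that no point of the box has an orbit staying in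
`[-3.017, 3.017] × [-6.083, 6.083]`. -/
def escapes (b₁ b₂ : ℤ) : ℕ → ℤ → ℤ → ℤ → ℤ → ℤ → Bool
  | 0, _, _, _, _, _ => false
  | k + 1, ul, uh, wl, wh, s =>
    decide (3017 * s < 1000 * ul) || decide (1000 * uh < -(3017 * s)) ||
    decide (6083 * s < 1000 * wl) || decide (1000 * wh < -(6083 * s)) ||
    (escapes b₁ b₂ k (mulLo b₁ b₂ (ul + s)) (mulHi b₁ b₂ (uh + s))
        (mulLo b₁ b₂ (wl - uh - s)) (mulHi b₁ b₂ (wh - ul - s)) (1000000000 * s) &&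
      escapes b₁ b₂ k (mulLo b₁ b₂ ul) (mulHi b₁ b₂ uh)
        (mulLo b₁ b₂ (wl - uh)) (mulHi b₁ b₂ (wh - ul)) (1000000000 * s) &&
      escapes b₁ b₂ k (mulLo b₁ b₂ (ul - s)) (mulHi b₁ b₂ (uh - s))
        (mulLo b₁ b₂ (wl - uh + s)) (mulHi b₁ b₂ (wh - ul + s)) (1000000000 * s))

/-- Runs the tree search on consecutive intervals of expansion factors. -/
def escapesChain : ℤ → List ℤ → Bool
  | _, [] => true
  -- The initial box contains `(-β, β)` for every `β` in `[b₁, b₂] / 10 ^ 9`.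
  | b₂, b₁ :: l => escapes b₁ b₂ 45 (-b₂) (-b₁) b₁ b₂ 1000000000 && escapesChain b₁ l

/-- Break points of the expansion factor, from `2` down to the reciprocal of the antenna bound. -/
def breakPoints : List ℤ :=
  [1574700324, 1555625830, 1538373220, 1517157173, 1511687410, 1506028588, 1501694131,
    1499087299, 1497809165, 1497196214, 1496715750, 1496443421, 1496286453, 1496189329,
    1496105947, 1496049288, 1496012952, 1495989383, 1495974302, 1495964711, 1495958445,
    1495953979, 1495950664, 1495948204, 1495946378, 1495945065, 1495944110, 1495943410,
    1495942874, 1495942477, 1495942170, 1495941933, 1495941743, 1495941597, 1495941482,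
    1495941393, 1495941324, 1495941271, 1495941231, 1495941199, 1495941174, 1495941154,
    1495941138, 1495941126]

theorem escapesChain_breakPoints : escapesChain 2000000000 breakPoints = true := by
  decide +kernel

/-! ### Certificate for the cover of the trap -/

/-- A subdivision tree of a box: `L k n` is a leaf with the `k` base three digits of `n` as word,
`O` marks a box that can be ignored, `U` and `W` halve the first and the second coordinate. -/
inductive CoverTree
  | L : ℕ → ℕ → CoverTree
  | O : CoverTree
  | U : CoverTree → CoverTree → CoverTree
  | W : CoverTree → CoverTree → CoverTree

namespace CoverTree

/-- Follows the word coded by its second argument, starting from a box with centre `(cu, cw)` and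
half widths `hu, hw` (scaled by `s`, sheared by the index `n`), with expansion factor `6265/4188`;
tests whether the final parallelogram lies in the trap. -/
def entersTrap : ℕ → ℕ → ℤ → ℤ → ℤ → ℤ → ℤ → ℤ → Bool
  | 0, _, n, cu, cw, hu, hw, s =>
    decide (10 * (|cu| + hu) ≤ 14 * s) && decide (10 * (|cw| + hw + n * hu) ≤ 25 * s) &&
    decide (10 * (|cw - cu| + hw + (n + 1) * hu) ≤ 14 * s) &&
    decide (10 * (|cw - 2 * cu| + hw + (n + 2) * hu) ≤ 28 * s)
  | k + 1, d, n, cu, cw, hu, hw, s =>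
    entersTrap k (d / 3) (n + 1) (6265 * (cu - (((d % 3 : ℕ) : ℤ) - 1) * s))
      (6265 * (cw - cu + (((d % 3 : ℕ) : ℤ) - 1) * s)) (6265 * hu) (6265 * hw) (4188 * s)

/-- Tests that a box does not meet the trap. -/
def avoidsTrap (cu cw hu hw s : ℤ) : Bool :=
  decide (14 * s < 10 * (|cu| - hu)) || decide (25 * s < 10 * (|cw| - hw)) ||
  decide (14 * s < 10 * (|cw - cu| - hw - hu)) ||
  decide (28 * s < 10 * (|cw - 2 * cu| - hw - 2 * hu))

/-- Checks that every point of the trap in a box is mapped into the trap by some word. -/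
def covers : CoverTree → ℤ → ℤ → ℤ → ℤ → ℤ → Bool
  -- A leaf codes `k + 1` digits, lowest first, so the word is never empty; the empty word would
  -- make the cover vacuous.
  | L k d, cu, cw, hu, hw, s => entersTrap (k + 1) d 0 cu cw hu hw s
  | O, cu, cw, hu, hw, s => avoidsTrap cu cw hu hw s
  | U l r, cu, cw, hu, hw, s =>
    covers l (2 * cu - hu) (2 * cw) hu (2 * hw) (2 * s) &&
    covers r (2 * cu + hu) (2 * cw) hu (2 * hw) (2 * s)
  | W l r, cu, cw, hu, hw, s =>
    covers l (2 * cu) (2 * cw - hw) (2 * hu) hw (2 * s) &&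
    covers r (2 * cu) (2 * cw + hw) (2 * hu) hw (2 * s)

def coverPart0 : CoverTree :=
  U (W (U (W O (U (L 1 2) (L 0 2))) O) (U (W (U (W (U (L 2 7) (L 1 7)) (U (W (L 2 7) (L 0 1)) (L
  1 7))) (L 1 7)) (U (L 0 1) (W (U (L 0 1) (L 2 7)) (L 0 1)))) (W (U (L 1 2) (L 0 2)) (U (W (L 1
  7) (L 0 1)) (L 1 7))))) (W O (U (W (L 0 2) (L 1 2)) (W (L 0 2) (U (W (L 0 2) (L 1 2)) (L 0
  2)))))

def coverPart1 : CoverTree :=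
  U (W (L 0 1) (U (W (U (W (L 0 1) (L 3 73)) (L 0 1)) (U (L 2 24) (W (L 3 73) (L 2 24)))) (W (L 0
  1) (U (W (L 0 1) (U (L 3 73) (L 4 220))) (W (L 0 1) (U (W (L 0 1) (L 4 78)) (L 3 78))))))) (L 0
  1)

def coverPart2 : CoverTree :=
  W (U (W (U (L 1 6) (L 2 24)) O) (W (U (L 2 24) (W (U (L 3 73) (L 3 78)) (L 2 24))) (L 1 6))) O

def coverPart3 : CoverTree :=
  W (U (W (U (W (L 3 78) (U (L 4 78) (L 3 78))) (W (U (W (L 0 1) (L 3 78)) (L 0 1)) (U (L 3 78)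
  (L 4 159)))) (U (L 2 24) (W (L 3 78) O))) (W (U (W (L 0 1) (U (W (U (L 3 40) (L 2 13)) (U (L 3
  78) (W (U (L 3 40) (L 2 13)) (L 4 159)))) (W (L 0 1) (U (W (L 2 13) (U (W (L 2 13) (L 4 159))
  (L 2 13))) (L 2 13))))) (L 2 13)) (U (W (U (L 3 78) (W (U (L 4 159) (W (U (L 5 402) (L 2 13))
  (L 5 402))) (L 3 78))) O) (W (U (W (L 2 13) (U (W (U (L 5 402) (L 5 445)) (L 5 402)) (W (L 2
  13) (U (L 5 445) (L 4 202))))) (L 2 13)) (U (W (U O (W (U (L 5 402) (W (U (L 5 402) (L 4 202))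
  O)) O)) O) (W (U (W (U (W (L 4 202) O) (L 4 202)) O) (L 4 202)) O)))))) O

def coverPart4 : CoverTree :=
  W (U (W (U (L 0 1) (W (L 1 7) (L 0 1))) (L 0 1)) (W (U (L 1 7) (L 1 2)) (L 0 1))) (U (W (U (W
  (L 0 1) (U (W (L 2 13) (U (L 4 202) (W (L 2 13) O))) (W (L 0 1) (U (L 2 13) (W (L 1 4) (U (W (L
  1 4) O) (L 1 4))))))) (L 1 4)) (U O (W (U (W (U O (L 4 148)) O) (W (L 1 4) O)) O))) (W (L 0 1)
  (U (W (U (W (L 1 4) O) (L 1 4)) O) (W (U (W (L 0 1) (U (W (L 0 1) O) (L 0 1))) (L 0 1)) O))))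

def coverPart5 : CoverTree :=
  U (W O (U (W (U (L 0 2) O) (L 0 2)) (W O (L 0 2)))) (W O (U (W O (U (L 0 2) (W O (L 0 2)))) (W
  O (U (W O (U (L 0 2) (L 1 8))) (L 1 8)))))

def coverPart6 : CoverTree :=
  U (W (U (W (L 0 2) (L 1 2)) (W (L 0 2) (L 2 25))) (U (L 1 7) (L 1 2))) (W (L 0 2) (U (W (L 2
  25) (L 1 7)) (W (U (W (L 0 2) (L 2 25)) (L 0 2)) (L 2 25))))

def coverPart7 : CoverTree :=
  W (L 0 1) (U (W (L 0 1) (U O (W (L 0 1) O))) (W (L 0 1) (U (L 2 22) (L 0 1))))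

def coverPart8 : CoverTree :=
  L 1 7

def coverPart9 : CoverTree :=
  U (L 0 1) (W (L 1 7) (U (W (L 3 43) (U (L 0 1) (L 3 43))) (W (L 1 7) (U (W (L 2 16) (U (L 3 43)
  (L 2 16))) (L 2 16)))))

def coverPart10 : CoverTree :=
  U (L 0 1) (W (U (W (U (L 0 1) (W (L 6 2068) (U (L 0 1) (L 6 2068)))) (U (L 0 1) (W (L 6 724) (U
  (L 0 1) (L 6 724))))) (W (U (W (U (L 3 43) (W (U (L 8 1453) (L 2 16)) (U (W (L 8 1453) (L 7
  6442)) (L 7 6464)))) (U (W (L 3 43) (L 6 2068)) (W (U (L 7 6442) (L 8 1453)) (L 7 6442)))) (W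
  (U (W (L 2 16) (L 7 6464)) (L 2 16)) (U (W (L 7 6464) (U (L 8 1453) (L 7 6464))) (W (U (L 7
  6464) (L 2 16)) (L 7 6464))))) (U (W (U (L 6 2068) (W (L 7 6442) (L 6 2068))) (L 6 2068)) (W (U
  (W (U (L 7 6442) (L 8 1453)) (U (L 7 6442) (L 8 1453))) (W (L 7 6464) (U (L 8 19564) (L 7
  6464)))) (U (L 7 6442) (W (U (L 8 1453) (L 7 6464)) (U (L 5 724) (L 8 1453)))))))) (U O (W (U
  (W (L 6 724) O) (W (U (L 6 2068) (L 5 724)) O)) O)))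

def coverPart11 : CoverTree :=
  L 2 16

def coverPart12 : CoverTree :=
  U (W (U (W (L 2 16) (U (W (L 2 16) (U (W (L 2 16) (U (L 7 6464) (L 2 16))) (L 2 16))) (L 2
  16))) (L 2 16)) (U (W (U (W (U (L 8 19586) (W (L 7 5551) (U (L 8 19586) (L 7 5551)))) (U (L 7
  6464) (L 8 19586))) (W (L 5 448) (U (W (L 7 5551) (L 9 58952)) (L 5 448)))) (U (L 7 6464) (W (U
  (W (U (L 8 19586) (L 9 58952)) (L 8 19586)) (L 7 5551)) (U (L 8 19586) (W (L 9 58952) (U (L 8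
  19586) (L 9 58952))))))) (W (L 2 16) (U (L 7 5551) (L 5 448))))) (L 2 16)

def coverPart13 : CoverTree :=
  U (W (U (W (U (W (U (L 8 1453) (L 7 1453)) (U (L 5 724) (L 7 1453))) (W (U (W (L 8 19586) (L 7
  1453)) (L 8 19586)) (U (L 7 1453) (L 8 19586)))) O) (W (U (W (U (W (L 9 51478) (L 9 58952)) (L
  7 5551)) (U (W (U (L 8 19586) (L 9 58952)) (L 8 19586)) (W (U (L 9 51478) (L 7 5551)) (L 9
  51478)))) (W (U (L 7 5551) (L 5 448)) (U (L 7 5551) (W (L 8 18673) (U (L 7 5551) (L 8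
  18673)))))) (U O (W (U O (W (U (L 7 5551) (L 8 18673)) O)) O)))) O) (W (U (W (U (L 5 448) (L 4
  205)) (U (W (U (L 8 18673) (L 5 448)) O) (W (U (L 5 448) (W (L 4 205) (L 9 58633))) O))) (W (L
  2 16) (U (W (L 4 205) O) (L 4 205)))) O)

def coverPart14 : CoverTree :=
  W (L 2 16) (U (W (L 2 16) (U O (L 4 205))) (W (L 2 16) (L 4 205)))

def coverPart15 : CoverTree :=
  U (W (L 0 2) (U (W (L 0 2) (U (L 3 74) (W (L 0 2) (U (L 3 74) (L 4 79))))) (W (L 0 2) (U (W (L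
  0 2) (L 3 79)) (L 0 2))))) (L 0 2)

def coverPart16 : CoverTree :=
  W (U (W (L 2 25) (L 1 7)) (W (U (W (U (L 4 214) (L 3 79)) (L 3 74)) (L 3 79)) (U (L 2 25) (W (U
  (L 2 25) (L 4 79)) (L 1 7))))) (U (W (L 1 7) (U (W (L 1 7) (U (L 2 16) (L 1 7))) (L 1 7))) (L 1
  7))

def coverPart17 : CoverTree :=
  U (W (U (W (U (W (L 0 2) (U (L 3 79) (L 0 2))) (L 0 2)) (U (L 3 79) (L 4 160))) (W (L 0 2) (U
  (W (L 2 14) (U (L 4 160) (W (L 2 14) (U (L 4 160) (W (L 2 14) (L 4 160)))))) (L 2 14)))) (U (W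
  (L 3 79) (U (L 2 25) (L 3 79))) (W (U (L 3 79) (W (U (L 5 403) (W (L 2 14) (U (L 5 403) (L 2
  14)))) (L 5 403))) (L 3 79)))) (W (L 1 5) (U (W (U (W (L 2 14) (U (W (L 5 446) (U (L 5 403) (L
  5 446))) (L 4 203))) (L 2 14)) (U (W (U (L 5 403) (W (U (W (U (L 5 403) (L 4 203)) (L 5 403))
  (L 4 203)) (U (L 3 79) (W (U (L 5 403) (L 4 203)) (L 5 403))))) (L 3 79)) (W (U (W (L 4 203) (U
  (L 7 4091) (L 4 203))) (L 4 203)) (U (W (U (L 6 1132) (W (L 4 203) (U (L 6 1132) (L 4 203))))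
  (L 3 79)) (W (L 4 203) (U (W (L 4 203) (U (L 3 79) (L 6 1904))) (L 4 203))))))) (W (L 2 14) (U
  (L 4 203) (L 2 14)))))

def coverPart18 : CoverTree :=
  U (W (U (L 1 7) (W (U (L 2 25) (L 3 79)) (L 2 25))) (U (L 1 7) (L 2 25))) (W (U (W (U (L 3 79)
  (W (U (L 3 79) (W (U (L 3 79) (W (L 6 1904) (L 3 79))) (L 3 79))) (L 3 79))) (L 3 79)) (W (U (W
  (U (W (L 4 203) (L 6 1904)) (L 4 203)) (U (L 3 79) (W (U (L 7 241) (L 4 203)) (U (L 3 79) (W (L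
  7 6278) (L 3 79)))))) (W (U (L 5 241) (L 5 689)) (U (W (L 5 241) (L 6 646)) (L 5 241)))) (U (L
  3 79) (W (U (W (U (L 3 79) (L 6 646)) (L 3 79)) (W (L 5 241) (L 6 646))) (L 3 79))))) (U (L 2
  25) (W (L 3 79) (L 2 25))))

/-- A cover of the right half of the trap by inverse branches. -/
def coverTree : CoverTree :=
  U (W coverPart0 (U (W coverPart1 (U coverPart2 coverPart3)) coverPart4)) (W coverPart5 (U (W
  coverPart6 (U coverPart7 (W coverPart8 (U (W coverPart9 coverPart10) (W coverPart11 (U (W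
  coverPart12 coverPart13) coverPart14)))))) (W coverPart15 (U coverPart16 (W coverPart17
  coverPart18)))))

-- Centre `(14, 0)`, half widths `14, 50` and scale `20` give the box `[0, 1.4] × [-2.5, 2.5]`.
theorem covers_coverTree : covers coverTree 14 0 14 50 20 = true := by
  decide +kernel

end CoverTree

/-! ### The end of a component on a line -/

/-- If the points of `[1/2, α]` avoid `K` on the line `ι` and some later point `y` lies in `K`, then
the component of `1/2` ends between `α` and `y`. -/
theorem exists_isLUB_component {X : Type*} [TopologicalSpace X] {ι : ℝ → X} {π : X → ℝ}
    (hι : Continuous ι) (hπ : Continuous π) (hπι : ∀ x, π (ι x) = x) {K : Set X} {α y : ℝ}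
    (hα : 1 / 2 ≤ α) (hα1 : α < 1) (hK : ∀ x ∈ Icc (1 / 2) α, ι x ∉ K)
    (hy : ι y ∈ K) (hy0 : 1 / 2 ≤ y) :
    ∃ s ∈ Icc α y, IsLUB {x | ι x ∈
      connectedComponentIn (ι '' Ico (1 / 2 : ℝ) 1 \ K) (ι (1 / 2))} s := by
  set F := ι '' Ico (1 / 2 : ℝ) 1 \ K
  set C := connectedComponentIn F (ι (1 / 2))
  have hsub : ι '' Icc (1 / 2) α ⊆ F := by
    rintro _ ⟨x, hx, rfl⟩
    exact ⟨mem_image_of_mem _ ⟨hx.1, hx.2.trans_lt hα1⟩, hK x hx⟩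
  have hIcc : ι '' Icc (1 / 2) α ⊆ C :=
    (isPreconnected_Icc.image ι hι.continuousOn).subset_connectedComponentIn
      (mem_image_of_mem _ ⟨le_rfl, hα⟩) hsub
  have hhalf : ι (1 / 2) ∈ C := hIcc (mem_image_of_mem _ ⟨le_rfl, hα⟩)
  have hub : y ∈ upperBounds {x | ι x ∈ C} := by
    intro x hx
    by_contra! hlt
    have hconn : (π '' C).OrdConnected :=
      (isPreconnected_connectedComponentIn.image π hπ.continuousOn).ordConnected
    have h1 : (1 / 2 : ℝ) ∈ π '' C := ⟨_, hhalf, hπι _⟩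
    have h2 : x ∈ π '' C := ⟨_, hx, hπι _⟩
    obtain ⟨c, hc, hcy⟩ := hconn.out h1 h2 ⟨hy0, hlt.le⟩
    have hcF := connectedComponentIn_subset F (ι (1 / 2)) hc
    obtain ⟨t, -, rfl⟩ := hcF.1
    rw [hπι] at hcy
    exact hcF.2 (hcy ▸ hy)
  obtain ⟨s, hs⟩ := Real.exists_isLUB (s := {x | ι x ∈ C}) ⟨_, hhalf⟩ ⟨y, hub⟩
  exact ⟨s, ⟨hs.1 (hIcc (mem_image_of_mem _ ⟨hα, le_rfl⟩)), hs.2 hub⟩, hs⟩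

/-! ### Limits of pairs of zeros -/

section Coefficients

variable {𝕜 : Type*} [RCLike 𝕜]

theorem abs_le_one_of_mem_classB {a : ℕ → ℤ} (ha : a ∈ classB) (n : ℕ) : |a n| ≤ 1 := by
  rcases Nat.eq_zero_or_pos n with rfl | hn
  · rw [ha.1, abs_one]
  · rcases ha.2 n hn with h | h | h <;> rw [h] <;> norm_num

theorem norm_intCast_le_one {c : ℤ} (hc : |c| ≤ 1) : ‖(c : 𝕜)‖ ≤ 1 := by
  rw [← RCLike.ofReal_intCast, RCLike.norm_ofReal, ← Int.cast_abs]
  exact_mod_cast hc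

theorem isCompact_classB : IsCompact classB := by
  have h : classB = Set.univ.pi
      (fun n => if n = 0 then ({1} : Set ℤ) else {-1, 0, 1}) := by
    ext a
    simp only [classB, mem_ofPred_eq, mem_univ_pi]
    constructor
    · rintro ⟨h0, h⟩ n
      split_ifs with hn
      · rw [hn, h0]; rfl
      · exact h n (Nat.one_le_iff_ne_zero.2 hn)
    · intro h
      refine ⟨by simpa using h 0, fun n hn => ?_⟩
      simpa [Nat.one_le_iff_ne_zero.1 hn] using h n
  rw [h]
  refine isCompact_univ_pi fun n => Set.Finite.isCompact ?_
  split_ifs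
  · exact finite_singleton _
  · exact toFinite _

theorem norm_geom_sum₂_le {z w : 𝕜} {ρ : ℝ} (hz : ‖z‖ ≤ ρ) (hw : ‖w‖ ≤ ρ) (n : ℕ) :
    ‖∑ i ∈ Finset.range n, z ^ i * w ^ (n - 1 - i)‖ ≤ n * ρ ^ (n - 1) := by
  have hρ : 0 ≤ ρ := (norm_nonneg z).trans hz
  calc _ ≤ ∑ i ∈ Finset.range n, ρ ^ (n - 1) := by
        refine norm_sum_le_of_le _ fun i hi => ?_
        have hi' : n - 1 = i + (n - 1 - i) := by
          have := Finset.mem_range.1 hi; omega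
        rw [norm_mul, norm_pow, norm_pow]
        conv_rhs => rw [hi', pow_add]
        gcongr
    _ = n * ρ ^ (n - 1) := by simp

theorem summable_nat_mul_pow_pred {ρ : ℝ} (h0 : 0 ≤ ρ) (h1 : ρ < 1) :
    Summable fun n : ℕ => (n : ℝ) * ρ ^ (n - 1) := by
  have h : ‖ρ‖ < 1 := by rwa [Real.norm_of_nonneg h0]
  rw [← summable_nat_add_iff 1]
  have := (summable_pow_mul_geometric_of_norm_lt_one 1 h).add
    (summable_geometric_of_norm_lt_one h)
  refine this.congr fun n => ?_
  push_cast
  simp; ring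

/-- A limit of pairs of distinct common zeros is a double zero. -/
theorem exists_double_zero_of_pairs {x : ℝ} (hx0 : 0 ≤ x) (hx1 : x < 1)
    (h : ∀ ε > 0, ∃ z w : 𝕜, z ≠ w ∧ ‖z - x‖ < ε ∧ ‖w - x‖ < ε ∧
      ∃ a ∈ classB, seriesSum a z = 0 ∧ seriesSum a w = 0) :
    ∃ a ∈ classB, ∑' n, (a n : ℝ) * x ^ n = 0 ∧ ∑' n : ℕ, (n : ℝ) * (a n * x ^ n) = 0 := by
  obtain ⟨ρ, hxρ, hρ1⟩ := exists_between hx1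
  have hρ0 : 0 ≤ ρ := hx0.trans hxρ.le
  have hpos : ∀ k : ℕ, 0 < min (ρ - x) (1 / ((k : ℝ) + 1)) := fun k =>
    lt_min (sub_pos.2 hxρ) Nat.one_div_pos_of_nat
  choose z w hzw hz hw b hb hbz hbw using fun k : ℕ => h _ (hpos k)
  obtain ⟨a, ha, φ, hφ, hlim⟩ := isCompact_classB.tendsto_subseq hb
  have norm_le : ∀ {y : 𝕜} {k : ℕ}, ‖y - x‖ < min (ρ - x) (1 / ((k : ℝ) + 1)) → ‖y‖ ≤ ρ := by
    intro y k hy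
    have h1 : ‖y‖ ≤ ‖y - x‖ + ‖(x : 𝕜)‖ := by simpa using norm_add_le (y - x) (x : 𝕜)
    rw [RCLike.norm_ofReal, abs_of_nonneg hx0] at h1
    linarith [hy.trans_le (min_le_left _ _)]
  have tends : ∀ {y : ℕ → 𝕜}, (∀ k, ‖y k - x‖ < min (ρ - x) (1 / ((k : ℝ) + 1))) →
      Tendsto (fun k => y (φ k)) atTop (𝓝 (x : 𝕜)) := by
    intro y hy
    refine Tendsto.comp ?_ hφ.tendsto_atTop
    rw [tendsto_iff_norm_sub_tendsto_zero]
    exact squeeze_zero (fun _ => norm_nonneg _)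
      (fun k => ((hy k).trans_le (min_le_right _ _)).le) tendsto_one_div_add_atTop_nhds_zero_nat
  have hcoef : ∀ n, Tendsto (fun k => ((b (φ k) n : ℤ) : 𝕜)) atTop (𝓝 (a n : 𝕜)) := fun n =>
    (continuous_of_discreteTopology (f := fun m : ℤ => (m : 𝕜))).continuousAt.tendsto.comp
      ((tendsto_pi_nhds.1 hlim) n)
  have hzero : ∑' n, (a n : 𝕜) * (x : 𝕜) ^ n = 0 := by
    have := tendsto_tsum_of_dominated_convergence (𝓕 := atTop)
      (f := fun k n => ((b (φ k) n : ℤ) : 𝕜) * z (φ k) ^ n)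
      (g := fun n => (a n : 𝕜) * (x : 𝕜) ^ n) (bound := fun n => ρ ^ n)
      (summable_geometric_of_lt_one hρ0 hρ1)
      (fun n => (hcoef n).mul ((tends hz).pow n))
      (Eventually.of_forall fun k n => by
        rw [norm_mul, norm_pow, ← one_mul (ρ ^ n)]
        exact mul_le_mul (norm_intCast_le_one (abs_le_one_of_mem_classB (hb _) n))
          (pow_le_pow_left₀ (norm_nonneg _) (norm_le (hz _)) n) (by positivity) zero_le_one)
    refine tendsto_nhds_unique this ?_
    have h0 : (fun k => ∑' n, ((b (φ k) n : ℤ) : 𝕜) * z (φ k) ^ n) = fun _ => 0 := by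
      funext k; exact hbz (φ k)
    rw [h0]; exact tendsto_const_nhds
  -- The inner sums are the divided differences of `y ^ n` at `z, w`. The series vanishes at both
  -- points, so its divided difference is `0`, and it tends to the derivative at `x`.
  have hderiv : ∑' n, (a n : 𝕜) *
      (∑ i ∈ Finset.range n, (x : 𝕜) ^ i * (x : 𝕜) ^ (n - 1 - i)) = 0 := by
    have := tendsto_tsum_of_dominated_convergence (𝓕 := atTop)
      (f := fun k n => ((b (φ k) n : ℤ) : 𝕜) *
        (∑ i ∈ Finset.range n, z (φ k) ^ i * w (φ k) ^ (n - 1 - i)))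
      (g := fun n => (a n : 𝕜) *
        (∑ i ∈ Finset.range n, (x : 𝕜) ^ i * (x : 𝕜) ^ (n - 1 - i)))
      (bound := fun n => n * ρ ^ (n - 1))
      (summable_nat_mul_pow_pred hρ0 hρ1)
      (fun n => (hcoef n).mul (tendsto_finsetSum _ fun i _ =>
        ((tends hz).pow i).mul ((tends hw).pow _)))
      (Eventually.of_forall fun k n => by
        rw [norm_mul, ← one_mul ((n : ℝ) * ρ ^ (n - 1))]
        exact mul_le_mul (norm_intCast_le_one (abs_le_one_of_mem_classB (hb _) n))
          (norm_geom_sum₂_le (norm_le (hz _)) (norm_le (hw _)) n) (by positivity) zero_le_one)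
    refine tendsto_nhds_unique this ?_
    have h0 : (fun k => ∑' n, ((b (φ k) n : ℤ) : 𝕜) *
        (∑ i ∈ Finset.range n, z (φ k) ^ i * w (φ k) ^ (n - 1 - i))) = fun _ => 0 := by
      funext k
      have hs : ∀ y : 𝕜, ‖y‖ ≤ ρ → Summable fun n => ((b (φ k) n : ℤ) : 𝕜) * y ^ n := by
        intro y hy
        refine Summable.of_norm_bounded (summable_geometric_of_lt_one hρ0 hρ1) fun n => ?_
        rw [norm_mul, norm_pow, ← one_mul (ρ ^ n)]
        exact mul_le_mul (norm_intCast_le_one (abs_le_one_of_mem_classB (hb _) n))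
          (pow_le_pow_left₀ (norm_nonneg _) hy n) (by positivity) zero_le_one
      have hne : z (φ k) - w (φ k) ≠ 0 := sub_ne_zero.2 (hzw _)
      refine (mul_eq_zero.1 (?_ : _ * (z (φ k) - w (φ k)) = 0)).resolve_right hne
      rw [← tsum_mul_right]
      simp_rw [mul_assoc, geom_sum₂_mul, mul_sub]
      rw [(hs _ (norm_le (hz _))).tsum_sub (hs _ (norm_le (hw _)))]
      have h1 := hbz (φ k)
      have h2 := hbw (φ k)
      simp only [seriesSum] at h1 h2
      rw [h1, h2, sub_zero]
    rw [h0]; exact tendsto_const_nhds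
  refine ⟨a, ha, ?_, ?_⟩
  · have : ((∑' n, (a n : ℝ) * x ^ n : ℝ) : 𝕜) = 0 := by
      rw [RCLike.ofReal_tsum, ← hzero]; push_cast; rfl
    exact_mod_cast this
  · have h1 : ((∑' n : ℕ, (n : ℝ) * (a n * x ^ n) : ℝ) : 𝕜) = 0 := by
      rw [RCLike.ofReal_tsum, ← zero_mul (x : 𝕜), ← hderiv, ← tsum_mul_right]
      refine tsum_congr fun n => ?_
      rw [Finset.sum_congr rfl (g := fun _ => (x : 𝕜) ^ (n - 1))]
      · rcases n with _ | n
        · simp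
        · simp; ring
      · intro i hi
        rw [← pow_add]
        congr 1
        have := Finset.mem_range.1 hi
        omega
    exact_mod_cast h1

end Coefficients

/-! ### Soundness of the escape search -/

/-- The action on pairs of removing the leading digit `c` of a power series with value `p.1` and
Euler derivative `p.2` at `β⁻¹`. -/
def shiftState (β c : ℝ) (p : ℝ × ℝ) : ℝ × ℝ := (β * (p.1 - c), β * (p.2 - p.1 + c))

theorem mulLo_le {b₁ b₂ l : ℤ} {B t : ℝ} (h0 : (0 : ℝ) ≤ b₁) (h1 : b₁ ≤ B) (h2 : B ≤ b₂)
    (hl : l ≤ t) : (mulLo b₁ b₂ l : ℝ) ≤ B * t := by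
  unfold mulLo
  have hB : 0 ≤ B := h0.trans h1
  split_ifs with h
  · have h' : (0 : ℝ) ≤ l := by exact_mod_cast h
    push_cast
    exact mul_le_mul h1 hl h' hB
  · have h' : (l : ℝ) ≤ 0 := by exact_mod_cast (not_le.1 h).le
    push_cast
    nlinarith [mul_le_mul_of_nonneg_left hl hB]

theorem le_mulHi {b₁ b₂ u : ℤ} {B t : ℝ} (h0 : (0 : ℝ) ≤ b₁) (h1 : b₁ ≤ B) (h2 : B ≤ b₂)
    (hu : t ≤ u) : B * t ≤ (mulHi b₁ b₂ u : ℝ) := by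
  unfold mulHi
  have hB : 0 ≤ B := h0.trans h1
  split_ifs with h
  · have h' : (0 : ℝ) ≤ u := by exact_mod_cast h
    push_cast
    nlinarith [mul_le_mul_of_nonneg_left hu hB]
  · have h' : (u : ℝ) ≤ 0 := by exact_mod_cast (not_le.1 h).le
    push_cast
    nlinarith [mul_le_mul_of_nonneg_left hu hB]

/-- A set in which every state is bounded and has a successor under some digit cannot meet a box
from which all three digits lead, within `k` steps, out of the bounds. `S` will be the set of all
tail states. -/
theorem escapes_sound {b₁ b₂ : ℤ} (hb : 0 ≤ b₁) {β : ℝ} (h1 : b₁ ≤ 1000000000 * β)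
    (h2 : 1000000000 * β ≤ b₂) {S : Set (ℝ × ℝ)}
    (hS : ∀ p ∈ S, |p.1| ≤ 3.017 ∧ |p.2| ≤ 6.083 ∧ ∃ c : ℤ, |c| ≤ 1 ∧ shiftState β c p ∈ S)
    (k : ℕ) : ∀ {ul uh wl wh s : ℤ}, 0 < s → escapes b₁ b₂ k ul uh wl wh s = true →
    ∀ p ∈ S, (ul : ℝ) ≤ s * p.1 → s * p.1 ≤ uh → wl ≤ s * p.2 → s * p.2 ≤ wh → False := by
  have hb' : (0 : ℝ) ≤ b₁ := by exact_mod_cast hb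
  induction k with
  | zero => intro ul uh wl wh s hs h; simp [escapes] at h
  | succ k ih =>
    intro ul uh wl wh s hs h p hp hul huh hwl hwh
    have hs' : (0 : ℝ) < s := by exact_mod_cast hs
    obtain ⟨hu, hw, c, hc, hpc⟩ := hS p hp
    rw [abs_le] at hu hw hc
    simp only [escapes, Bool.or_eq_true, Bool.and_eq_true, decide_eq_true_eq] at h
    rcases h with (((h | h) | h) | h) | h
    · have h' : (3017 * s : ℝ) < 1000 * ul := by exact_mod_cast h
      nlinarith
    · have h' : (1000 * uh : ℝ) < -(3017 * s) := by exact_mod_cast h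
      nlinarith
    · have h' : (6083 * s : ℝ) < 1000 * wl := by exact_mod_cast h
      nlinarith
    · have h' : (1000 * wh : ℝ) < -(6083 * s) := by exact_mod_cast h
      nlinarith
    have key : ∀ l u l' u' : ℤ, (l : ℝ) ≤ s * (p.1 - c) → s * (p.1 - c) ≤ u →
        l' ≤ s * (p.2 - p.1 + c) → s * (p.2 - p.1 + c) ≤ u' →
        ¬ escapes b₁ b₂ k (mulLo b₁ b₂ l) (mulHi b₁ b₂ u) (mulLo b₁ b₂ l') (mulHi b₁ b₂ u')
          (1000000000 * s) = true := by
      intro l u l' u' hl hu hl' hu' hk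
      have e : ∀ t : ℝ, ((1000000000 * s : ℤ) : ℝ) * (β * t) = 1000000000 * β * (s * t) := by
        intro t; push_cast; ring
      refine ih (by positivity) hk _ hpc ?_ ?_ ?_ ?_ <;> simp only [shiftState, e]
      · exact mulLo_le hb' h1 h2 hl
      · exact le_mulHi hb' h1 h2 hu
      · exact mulLo_le hb' h1 h2 hl'
      · exact le_mulHi hb' h1 h2 hu'
    obtain rfl | rfl | rfl : c = -1 ∨ c = 0 ∨ c = 1 := by omega
    · refine key _ _ _ _ ?_ ?_ ?_ ?_ h.1.1 <;> push_cast <;> linarith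
    · refine key _ _ _ _ ?_ ?_ ?_ ?_ h.1.2 <;> push_cast <;> linarith
    · refine key _ _ _ _ ?_ ?_ ?_ ?_ h.2 <;> push_cast <;> linarith

theorem escapesChain_sound {β : ℝ} {S : Set (ℝ × ℝ)}
    (hS : ∀ p ∈ S, |p.1| ≤ 3.017 ∧ |p.2| ≤ 6.083 ∧ ∃ c : ℤ, |c| ≤ 1 ∧ shiftState β c p ∈ S)
    (l : List ℤ) : ∀ {b : ℤ}, escapesChain b l = true → 1000000000 * β ≤ b →
    (∀ b' ∈ l, 0 ≤ b') → (∃ b' ∈ l, b' ≤ 1000000000 * β) → (-β, β) ∉ S := by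
  induction l with
  | nil => intro b _ _ _ h; simp at h
  | cons b₁ l ih =>
    intro b h hβ hpos hlast hmem
    simp only [escapesChain, Bool.and_eq_true] at h
    by_cases hb : (b₁ : ℝ) ≤ 1000000000 * β
    · refine escapes_sound (hpos b₁ (by simp)) hb hβ hS 45 (by norm_num) h.1 _ hmem ?_ ?_ ?_ ?_ <;>
        push_cast <;> linarith
    · refine ih h.2 (not_le.1 hb).le (fun b' hb' => hpos b' (by simp [hb'])) ?_ hmem
      obtain ⟨b', hb', hle⟩ := hlast
      rcases List.mem_cons.1 hb' with rfl | hb'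
      · exact absurd hle hb
      · exact ⟨b', hb', hle⟩

/-! ### Tails of series as states -/

section Tails

variable {x : ℝ} {b : ℕ → ℤ}

theorem norm_coeff_mul_pow_le (hx0 : 0 ≤ x) (hb : ∀ n, |b n| ≤ 1) (n : ℕ) :
    ‖(b n : ℝ) * x ^ n‖ ≤ x ^ n := by
  rw [norm_mul, Real.norm_of_nonneg (pow_nonneg hx0 n)]
  exact mul_le_of_le_one_left (pow_nonneg hx0 n) (norm_intCast_le_one (hb n))

theorem norm_nat_mul_coeff_mul_pow_le (hx0 : 0 ≤ x) (hb : ∀ n, |b n| ≤ 1) (n : ℕ) :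
    ‖(n : ℝ) * (b n * x ^ n)‖ ≤ n * x ^ n := by
  rw [norm_mul, Real.norm_of_nonneg (Nat.cast_nonneg n)]
  exact mul_le_mul_of_nonneg_left (norm_coeff_mul_pow_le hx0 hb n) (Nat.cast_nonneg n)

theorem summable_coeff_mul_pow (hx0 : 0 ≤ x) (hx1 : x < 1) (hb : ∀ n, |b n| ≤ 1) :
    Summable fun n => (b n : ℝ) * x ^ n :=
  Summable.of_norm_bounded (summable_geometric_of_lt_one hx0 hx1) (norm_coeff_mul_pow_le hx0 hb)

theorem summable_nat_mul_coeff_mul_pow (hx0 : 0 ≤ x) (hx1 : x < 1) (hb : ∀ n, |b n| ≤ 1) :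
    Summable fun n : ℕ => (n : ℝ) * (b n * x ^ n) :=
  Summable.of_norm_bounded (hasSum_coe_mul_geometric_of_norm_lt_one
    (by rwa [Real.norm_of_nonneg hx0])).summable (norm_nat_mul_coeff_mul_pow_le hx0 hb)

/-- The value and the Euler derivative at `x` of the power series with coefficients `b`. -/
noncomputable def seriesState (x : ℝ) (b : ℕ → ℤ) : ℝ × ℝ :=
  (∑' n, (b n : ℝ) * x ^ n, ∑' n : ℕ, (n : ℝ) * (b n * x ^ n))

theorem abs_seriesState_fst_le (hx0 : 0 ≤ x) (hx1 : x < 1) (hb : ∀ n, |b n| ≤ 1) :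
    |(seriesState x b).1| ≤ (1 - x)⁻¹ := by
  rw [← tsum_geometric_of_lt_one hx0 hx1, ← Real.norm_eq_abs]
  exact tsum_of_norm_bounded (summable_geometric_of_lt_one hx0 hx1).hasSum
    (norm_coeff_mul_pow_le hx0 hb)

theorem abs_seriesState_snd_le (hx0 : 0 ≤ x) (hx1 : x < 1) (hb : ∀ n, |b n| ≤ 1) :
    |(seriesState x b).2| ≤ x / (1 - x) ^ 2 :=
  tsum_of_norm_bounded (hasSum_coe_mul_geometric_of_norm_lt_one
    (by rwa [Real.norm_of_nonneg hx0])) (norm_nat_mul_coeff_mul_pow_le hx0 hb)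

/-- If `f = b 0 + x g`, the Euler derivatives satisfy `θf = x (g + θg)`; solving for `g` and `θg`
gives `shiftState`. -/
theorem seriesState_shift (hx0 : 0 < x) (hx1 : x < 1) (hb : ∀ n, |b n| ≤ 1) :
    seriesState x (fun n => b (n + 1)) = shiftState x⁻¹ (b 0) (seriesState x b) := by
  have hb' : ∀ n, |b (n + 1)| ≤ 1 := fun n => hb _
  have s1 := summable_coeff_mul_pow hx0.le hx1 hb'
  have s2 := summable_nat_mul_coeff_mul_pow hx0.le hx1 hb'
  have e1 : (seriesState x b).1 = b 0 + x * (seriesState x fun n => b (n + 1)).1 := by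
    simp only [seriesState]
    rw [(summable_coeff_mul_pow hx0.le hx1 hb).tsum_eq_zero_add, ← tsum_mul_left]
    simp only [pow_zero, mul_one]
    congr 1
    exact tsum_congr fun n => by ring
  have e2 : (seriesState x b).2 = x * ((seriesState x fun n => b (n + 1)).1 +
      (seriesState x fun n => b (n + 1)).2) := by
    simp only [seriesState]
    rw [(summable_nat_mul_coeff_mul_pow hx0.le hx1 hb).tsum_eq_zero_add, ← s1.tsum_add s2,
      ← tsum_mul_left]
    simp only [Nat.cast_zero, zero_mul, zero_add]
    exact tsum_congr fun n => by push_cast; ring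
  have hx : x ≠ 0 := hx0.ne'
  ext
  · simp only [shiftState]; rw [e1]; field_simp; ring
  · simp only [shiftState]; rw [e2, e1]; field_simp; ring

end Tails

/-- No power series in `ℬ` has a double zero in `[1/2, 0.668475505]`. -/
theorem no_double_zero {x : ℝ} (hx : x ∈ Icc (1 / 2) 0.668475505) {a : ℕ → ℤ} (ha : a ∈ classB)
    (h1 : ∑' n, (a n : ℝ) * x ^ n = 0) (h2 : ∑' n : ℕ, (n : ℝ) * (a n * x ^ n) = 0) : False := by
  obtain ⟨hxl, hxu⟩ := hx
  have hx0 : 0 < x := by linarith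
  have hx1 : x < 1 := by linarith
  have hab := abs_le_one_of_mem_classB ha
  have hinv : 1 ≤ x⁻¹ * 0.668475505 := by
    rw [inv_mul_eq_div, le_div_iff₀ hx0]; linarith
  have hinv2 : x⁻¹ ≤ 2 := by
    rw [inv_le_comm₀ hx0 two_pos]; linarith
  -- The bounds `3.017` and `6.083` exceed `1 / (1 - x)` and `x / (1 - x) ^ 2` at the right end
  -- `0.668475505`; the last break point lies just below the reciprocal of that end.
  refine escapesChain_sound (β := x⁻¹)
    (S := seriesState x '' {b | ∀ n, |b n| ≤ 1}) ?_ breakPoints escapesChain_breakPoints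
    (by push_cast; linarith) (by decide +kernel)
    ⟨1495941126, by decide +kernel, by push_cast; linarith⟩
    ⟨fun n => a (n + 1), fun n => hab _, ?_⟩
  · rintro _ ⟨b, hb, rfl⟩
    refine ⟨(abs_seriesState_fst_le hx0.le hx1 hb).trans ?_,
      (abs_seriesState_snd_le hx0.le hx1 hb).trans ?_, b 0, hb 0, fun n => b (n + 1),
      fun n => hb _, seriesState_shift hx0 hx1 hb⟩
    · rw [inv_le_comm₀ (by linarith) (by norm_num)]; linarith
    · rw [div_le_iff₀ (by nlinarith)]; nlinarith
  · rw [seriesState_shift hx0 hx1 hab, ha.1]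
    simp [shiftState, seriesState, h1, h2]

/-! ### The trap and its orbits at `4188 / 6265` -/

/-- The convex set of states that is covered by its images under inverse branches. -/
def Trap (p : ℝ × ℝ) : Prop :=
  |p.1| ≤ 1.4 ∧ |p.2| ≤ 2.5 ∧ |p.2 - p.1| ≤ 1.4 ∧ |p.2 - 2 * p.1| ≤ 2.8

/-- The states from which some word of digits leads into the trap. -/
inductive ReachesTrap : ℝ × ℝ → Prop
  | trap {p : ℝ × ℝ} : Trap p → ReachesTrap p
  | step {p : ℝ × ℝ} (c : ℤ) : |c| ≤ 1 → ReachesTrap (shiftState (6265 / 4188) c p) →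
      ReachesTrap p

theorem shiftState_neg (β c : ℝ) (p : ℝ × ℝ) : shiftState β (-c) (-p) = -shiftState β c p := by
  ext <;> simp [shiftState] <;> ring

theorem Trap.neg {p : ℝ × ℝ} (h : Trap p) : Trap (-p) := by
  obtain ⟨h1, h2, h3, h4⟩ := h
  refine ⟨by simpa using h1, by simpa using h2, ?_, ?_⟩
  · rw [← abs_neg]; convert h3 using 2; simp; ring
  · rw [← abs_neg]; convert h4 using 2; simp; ring

theorem ReachesTrap.neg {p : ℝ × ℝ} (h : ReachesTrap p) : ReachesTrap (-p) := by
  induction h with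
  | trap h => exact .trap h.neg
  | step c hc _ ih =>
    refine .step (-c) (by rwa [abs_neg]) ?_
    rw [Int.cast_neg, shiftState_neg]
    exact ih

/-- Undoing a digit gives `u = c + x u'` and `w = x (u' + w')`. The bound `6265 / 2077` is `1 / (1 -
x)`, the fixed point of `t ↦ 1 + x t`; it stays strict because it is strict on the trap, which later
excludes constant digit tails. -/
theorem ReachesTrap.bounds {p : ℝ × ℝ} (h : ReachesTrap p) :
    |p.1| < 6265 / 2077 ∧ |p.2| ≤ 6.4 := by
  induction h with
  | trap h => exact ⟨h.1.trans_lt (by norm_num), h.2.1.trans (by norm_num)⟩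
  | step c hc _ ih =>
    have hc' : |(c : ℝ)| ≤ 1 := by exact_mod_cast hc
    simp only [shiftState, abs_lt, abs_le] at ih hc' ⊢
    refine ⟨⟨?_, ?_⟩, ?_, ?_⟩ <;> linarith

/-- Membership of a state in the parallelogram with scaled integer data. -/
def InBox (n : ℕ) (cu cw hu hw s : ℤ) (p : ℝ × ℝ) : Prop :=
  |s * p.1 - cu| ≤ hu ∧ |s * p.2 - cw + n * (s * p.1 - cu)| ≤ hw

/-- The linear part of the shift is `β` times a unit shear. Measuring the second deviation in
coordinates sheared by `n` absorbs it, so the parallelogram is tracked exactly, without interval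
overestimation. -/
theorem InBox.shiftState {n : ℕ} {cu cw hu hw s : ℤ} {p : ℝ × ℝ} (h : InBox n cu cw hu hw s p)
    (a : ℤ) : InBox (n + 1) (6265 * (cu - a * s)) (6265 * (cw - cu + a * s)) (6265 * hu)
      (6265 * hw) (4188 * s) (shiftState (6265 / 4188) a p) := by
  simp only [InBox, ConnLoci.shiftState, abs_le] at h ⊢
  push_cast
  refine ⟨⟨?_, ?_⟩, ?_, ?_⟩ <;> linarith

namespace CoverTree

theorem entersTrap_sound (k : ℕ) : ∀ {d n : ℕ} {cu cw hu hw s : ℤ} {p : ℝ × ℝ}, 0 < s →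
    InBox n cu cw hu hw s p → entersTrap k d n cu cw hu hw s = true → ReachesTrap p := by
  induction k with
  | zero =>
    intro d n cu cw hu hw s p hs hp h
    simp only [entersTrap, Bool.and_eq_true, decide_eq_true_eq] at h
    obtain ⟨⟨⟨h1, h2⟩, h3⟩, h4⟩ := h
    have hs' : (0 : ℝ) < s := by exact_mod_cast hs
    have e1 : (10 * (|(cu : ℝ)| + hu)) ≤ 14 * s := by exact_mod_cast h1
    have e2 : (10 * (|(cw : ℝ)| + hw + n * hu)) ≤ 25 * s := by exact_mod_cast h2
    have e3 : (10 * (|(cw : ℝ) - cu| + hw + (n + 1) * hu)) ≤ 14 * s := by exact_mod_cast h3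
    have e4 : (10 * (|(cw : ℝ) - 2 * cu| + hw + (n + 2) * hu)) ≤ 28 * s := by exact_mod_cast h4
    obtain ⟨b1, b2⟩ := hp
    have hn : |(n : ℝ) * (s * p.1 - cu)| ≤ n * hu := by
      rw [abs_mul, Nat.abs_cast]
      exact mul_le_mul_of_nonneg_left b1 n.cast_nonneg
    have scale : ∀ {t A : ℝ}, |s * t| ≤ s * A → |t| ≤ A := by
      intro t A h
      rw [abs_mul, abs_of_pos hs'] at h
      exact le_of_mul_le_mul_left h hs'
    rw [abs_le] at b1 b2 hn
    refine .trap ⟨scale ?_, scale ?_, scale ?_, scale ?_⟩ <;> rw [abs_le] <;> constructor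
    · linarith [neg_abs_le (cu : ℝ)]
    · linarith [le_abs_self (cu : ℝ)]
    · linarith [neg_abs_le (cw : ℝ)]
    · linarith [le_abs_self (cw : ℝ)]
    · linarith [neg_abs_le ((cw : ℝ) - cu)]
    · linarith [le_abs_self ((cw : ℝ) - cu)]
    · linarith [neg_abs_le ((cw : ℝ) - 2 * cu)]
    · linarith [le_abs_self ((cw : ℝ) - 2 * cu)]
  | succ k ih =>
    intro d n cu cw hu hw s p hs hp h
    rw [entersTrap] at h
    exact .step (((d % 3 : ℕ) : ℤ) - 1) (by rw [abs_le]; omega)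
      (ih (by positivity) (hp.shiftState _) h)

theorem entersTrap_succ_sound {k d : ℕ} {cu cw hu hw s : ℤ} {p : ℝ × ℝ} (hs : 0 < s)
    (hp : InBox 0 cu cw hu hw s p) (h : entersTrap (k + 1) d 0 cu cw hu hw s = true) :
    ∃ c : ℤ, |c| ≤ 1 ∧ ReachesTrap (shiftState (6265 / 4188) c p) := by
  rw [entersTrap] at h
  exact ⟨((d % 3 : ℕ) : ℤ) - 1, by rw [abs_le]; omega,
    entersTrap_sound k (by positivity) (hp.shiftState _) h⟩

theorem avoidsTrap_sound {cu cw hu hw s : ℤ} {p : ℝ × ℝ} (hs : 0 < s)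
    (hp : InBox 0 cu cw hu hw s p) (h : avoidsTrap cu cw hu hw s = true) : ¬ Trap p := by
  rintro ⟨t1, t2, t3, t4⟩
  have hs' : (0 : ℝ) < s := by exact_mod_cast hs
  obtain ⟨b1, b2⟩ := hp
  have scale : ∀ {t A : ℝ}, |t| ≤ A → |s * t| ≤ s * A := by
    intro t A h
    rw [abs_mul, abs_of_pos hs']
    exact mul_le_mul_of_nonneg_left h hs'.le
  replace t1 := abs_le.1 (scale t1)
  replace t2 := abs_le.1 (scale t2)
  replace t3 := abs_le.1 (scale t3)
  replace t4 := abs_le.1 (scale t4)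
  rw [abs_le] at b1 b2
  simp only [Nat.cast_zero, zero_mul, add_zero] at b2
  simp only [avoidsTrap, Bool.or_eq_true, decide_eq_true_eq] at h
  rcases h with ((h | h) | h) | h
  · have e : (14 * s : ℝ) < 10 * (|(cu : ℝ)| - hu) := by exact_mod_cast h
    have : |(cu : ℝ)| ≤ s * 1.4 + hu := abs_le.2 ⟨by linarith, by linarith⟩
    linarith
  · have e : (25 * s : ℝ) < 10 * (|(cw : ℝ)| - hw) := by exact_mod_cast h
    have : |(cw : ℝ)| ≤ s * 2.5 + hw := abs_le.2 ⟨by linarith, by linarith⟩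
    linarith
  · have e : (14 * s : ℝ) < 10 * (|(cw : ℝ) - cu| - hw - hu) := by exact_mod_cast h
    have : |(cw : ℝ) - cu| ≤ s * 1.4 + hw + hu := abs_le.2 ⟨by linarith, by linarith⟩
    linarith
  · have e : (28 * s : ℝ) < 10 * (|(cw : ℝ) - 2 * cu| - hw - 2 * hu) := by exact_mod_cast h
    have : |(cw : ℝ) - 2 * cu| ≤ s * 2.8 + hw + 2 * hu := abs_le.2 ⟨by linarith, by linarith⟩
    linarith

theorem covers_sound (t : CoverTree) : ∀ {cu cw hu hw s : ℤ} {p : ℝ × ℝ}, 0 < s →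
    InBox 0 cu cw hu hw s p → covers t cu cw hu hw s = true → Trap p →
    ∃ c : ℤ, |c| ≤ 1 ∧ ReachesTrap (shiftState (6265 / 4188) c p) := by
  induction t with
  | L k d => intro cu cw hu hw s p hs hp h _; exact entersTrap_succ_sound hs hp h
  | O => intro cu cw hu hw s p hs hp h ht; exact absurd ht (avoidsTrap_sound hs hp h)
  | U l r ihl ihr =>
    intro cu cw hu hw s p hs hp h ht
    simp only [covers, Bool.and_eq_true] at h
    simp only [InBox, abs_le, Nat.cast_zero, zero_mul, add_zero] at hp
    rcases le_total ((s : ℝ) * p.1) cu with hle | hle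
    · refine ihl (by positivity) ?_ h.1 ht
      simp only [InBox, abs_le, Nat.cast_zero, zero_mul, add_zero]
      push_cast
      refine ⟨⟨?_, ?_⟩, ?_, ?_⟩ <;> linarith
    · refine ihr (by positivity) ?_ h.2 ht
      simp only [InBox, abs_le, Nat.cast_zero, zero_mul, add_zero]
      push_cast
      refine ⟨⟨?_, ?_⟩, ?_, ?_⟩ <;> linarith
  | W l r ihl ihr =>
    intro cu cw hu hw s p hs hp h ht
    simp only [covers, Bool.and_eq_true] at h
    simp only [InBox, abs_le, Nat.cast_zero, zero_mul, add_zero] at hp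
    rcases le_total ((s : ℝ) * p.2) cw with hle | hle
    · refine ihl (by positivity) ?_ h.1 ht
      simp only [InBox, abs_le, Nat.cast_zero, zero_mul, add_zero]
      push_cast
      refine ⟨⟨?_, ?_⟩, ?_, ?_⟩ <;> linarith
    · refine ihr (by positivity) ?_ h.2 ht
      simp only [InBox, abs_le, Nat.cast_zero, zero_mul, add_zero]
      push_cast
      refine ⟨⟨?_, ?_⟩, ?_, ?_⟩ <;> linarith

end CoverTree

open CoverTree

/-- The tree covers the half `0 ≤ p.1`; the symmetry `p ↦ -p`, `c ↦ -c` gives the other half. -/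
theorem Trap.exists_step {p : ℝ × ℝ} (h : Trap p) :
    ∃ c : ℤ, |c| ≤ 1 ∧ ReachesTrap (shiftState (6265 / 4188) c p) := by
  have key : ∀ {q : ℝ × ℝ}, Trap q → 0 ≤ q.1 →
      ∃ c : ℤ, |c| ≤ 1 ∧ ReachesTrap (shiftState (6265 / 4188) c q) := by
    intro q hq h0
    refine covers_sound coverTree (by norm_num) ?_ covers_coverTree hq
    have h1 := abs_le.1 hq.1
    have h2 := abs_le.1 hq.2.1
    simp only [InBox, abs_le, Nat.cast_zero, zero_mul, add_zero]
    push_cast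
    refine ⟨⟨?_, ?_⟩, ?_, ?_⟩ <;> linarith
  rcases le_total 0 p.1 with h0 | h0
  · exact key h h0
  · obtain ⟨c, hc, hr⟩ := key h.neg (by simpa using h0)
    refine ⟨-c, by rwa [abs_neg], ?_⟩
    have := hr.neg
    rwa [← shiftState_neg, neg_neg, ← Int.cast_neg] at this

theorem ReachesTrap.exists_step {p : ℝ × ℝ} (h : ReachesTrap p) :
    ∃ c : ℤ, |c| ≤ 1 ∧ ReachesTrap (shiftState (6265 / 4188) c p) := by
  cases h with
  | trap h => exact h.exists_step
  | step c hc h => exact ⟨c, hc, h⟩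

/-- A bounded orbit of states with its digits. -/
def IsOrbit (q : ℕ → ℝ × ℝ) (c : ℕ → ℤ) : Prop :=
  ∀ n, |c n| ≤ 1 ∧ q (n + 1) = shiftState (6265 / 4188) (c n) (q n) ∧
    |(q n).1| < 6265 / 2077 ∧ |(q n).2| ≤ 6.4

theorem ReachesTrap.exists_orbit {p : ℝ × ℝ} (h : ReachesTrap p) :
    ∃ q c, IsOrbit q c ∧ q 0 = p := by
  choose c hc hr using fun p : {p // ReachesTrap p} => p.2.exists_step
  let f : {p // ReachesTrap p} → {p // ReachesTrap p} := fun p => ⟨_, hr p⟩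
  refine ⟨fun n => (f^[n] ⟨p, h⟩).1, fun n => c (f^[n] ⟨p, h⟩), fun n => ⟨hc _, ?_, ?_⟩, rfl⟩
  · simp only [Function.iterate_succ_apply', f]
  · exact (f^[n] ⟨p, h⟩).2.bounds

theorem summable_bounded_mul_pow {𝕜 : Type*} [RCLike 𝕜] {g : ℕ → ℝ} {M : ℝ}
    (hg : ∀ n, |g n| ≤ M) {y : 𝕜} (hy : ‖y‖ < 1) : Summable fun n => (g n : 𝕜) * y ^ n := by
  refine Summable.of_norm_bounded
    ((summable_geometric_of_lt_one (norm_nonneg y) hy).mul_left M) fun n => ?_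
  rw [norm_mul, norm_pow, RCLike.norm_ofReal]
  exact mul_le_mul_of_nonneg_right (hg n) (by positivity)

/-- There is an orbit from `p` whose second coordinates have generating function at least `ζ`
at `4188 / 6265`. -/
def HasOrbit (p : ℝ × ℝ) (ζ : ℝ) : Prop :=
  ∃ q c, IsOrbit q c ∧ q 0 = p ∧ ζ ≤ ∑' n, (q n).2 * (4188 / 6265) ^ n

theorem ReachesTrap.hasOrbit {p : ℝ × ℝ} (h : ReachesTrap p) : HasOrbit p (-20) := by
  obtain ⟨q, c, hq, h0⟩ := h.exists_orbit
  refine ⟨q, c, hq, h0, ?_⟩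
  have hgeo := hasSum_geometric_of_lt_one (r := (4188 / 6265 : ℝ)) (by norm_num) (by norm_num)
  have := tsum_of_norm_bounded (f := fun n => (q n).2 * (4188 / 6265 : ℝ) ^ n)
    (hgeo.mul_left 6.4) (fun n => by
      rw [norm_mul, norm_pow, Real.norm_of_nonneg (by norm_num : (0 : ℝ) ≤ 4188 / 6265)]
      exact mul_le_mul_of_nonneg_right (hq n).2.2.2 (by positivity))
  rw [Real.norm_eq_abs, abs_le] at this
  refine le_trans ?_ this.1
  norm_num

theorem HasOrbit.cons {p p' : ℝ × ℝ} {ζ : ℝ} (c : ℤ) (hc : |c| ≤ 1)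
    (hpp : p' = shiftState (6265 / 4188) c p) (h1 : |p.1| < 6265 / 2077) (h2 : |p.2| ≤ 6.4)
    (h : HasOrbit p' ζ) : HasOrbit p (p.2 + 4188 / 6265 * ζ) := by
  obtain ⟨q, e, hq, h0, hζ⟩ := h
  have hq' : IsOrbit (fun n => Nat.casesOn n p q) (fun n => Nat.casesOn n c e) := by
    rintro (_ | n)
    · exact ⟨hc, h0.trans hpp, h1, h2⟩
    · exact hq n
  refine ⟨_, _, hq', rfl, ?_⟩
  have hs := summable_bounded_mul_pow (𝕜 := ℝ) (g := fun n => ((Nat.casesOn n p q : ℝ × ℝ)).2)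
    (y := 4188 / 6265) (fun n => (hq' n).2.2.2)
    (by rw [Real.norm_of_nonneg (by norm_num)]; norm_num)
  have := hs.tsum_eq_zero_add
  simp only [RCLike.ofReal_real_eq_id, id, pow_zero, mul_one, pow_succ] at this
  rw [this]
  refine add_le_add_right ?_ p.2
  simp_rw [mul_comm _ (4188 / 6265 : ℝ), mul_left_comm _ (4188 / 6265 : ℝ), tsum_mul_left]
  refine mul_le_mul_of_nonneg_left ?_ (by norm_num)
  simpa only [mul_comm] using hζ

/-- The digits `-1, -1, -1, 1` make the early second coordinates large and positive, which outweighs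
the crude bound `-20` on the rest of the generating function. -/
theorem exists_orbit_pos : ∃ q c, IsOrbit q c ∧ q 0 = (-(6265 / 4188), 6265 / 4188) ∧
    0 < ∑' n, (q n).2 * (4188 / 6265 : ℝ) ^ n := by
  -- This is the exact state after those four digits, over the denominator `4188 ^ 5`. A box of
  -- width zero is followed along 33 further digits into the trap.
  have h5 : ReachesTrap (2069009591251134035 / 1288348526336007168,
      5673021089926052765 / 1288348526336007168) := by
    refine entersTrap_sound 33 (d := 5558213143963141) (n := 0) (cu := 2069009591251134035)
      (cw := 5673021089926052765) (hu := 0) (hw := 0) (s := 1288348526336007168) (by norm_num) ?_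
      (by decide +kernel)
    simp only [InBox]
    norm_num
  have h4 := HasOrbit.cons (p := (637877525101355/307628587950336, 77234942948695/19226786746896)) (1) (by norm_num)
    (by simp only [shiftState]; norm_num) (by norm_num [abs_lt]) (by norm_num [abs_le]) h5.hasOrbit
  have h3 := HasOrbit.cons (p := (28361272835/73454772672, 99688034705/24484924224)) (-1) (by norm_num)
    (by simp only [shiftState]; norm_num) (by norm_num [abs_lt]) (by norm_num [abs_le]) h4
  have h2 := HasOrbit.cons (p := (-13012405/17539344, 26131315/8769672)) (-1) (by norm_num)
    (by simp only [shiftState]; norm_num) (by norm_num [abs_lt]) (by norm_num [abs_le]) h3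
  have h1 := HasOrbit.cons (p := (-6265/4188, 6265/4188)) (-1) (by norm_num)
    (by simp only [shiftState]; norm_num) (by norm_num [abs_lt]) (by norm_num [abs_le]) h2
  obtain ⟨q, c, hq, h0, hζ⟩ := h1
  exact ⟨q, c, hq, by rw [h0]; norm_num, lt_of_lt_of_le (by norm_num) hζ⟩

/-! ### Factoring and perturbing power series -/

section PowerSeries

variable {𝕜 : Type*} [RCLike 𝕜]

theorem continuousAt_tsum_bounded_mul_pow {g : ℕ → ℝ} {M : ℝ} (hg : ∀ n, |g n| ≤ M) {y : 𝕜}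
    (hy : ‖y‖ < 1) : ContinuousAt (fun y : 𝕜 => ∑' n, (g n : 𝕜) * y ^ n) y := by
  obtain ⟨ρ, hyρ, hρ⟩ := exists_between hy
  have hρ0 : 0 ≤ ρ := (norm_nonneg y).trans hyρ.le
  refine ContinuousOn.continuousAt (s := Metric.ball 0 ρ) (continuousOn_tsum
    (fun n => by fun_prop) ((summable_geometric_of_lt_one hρ0 hρ).mul_left M) fun n z hz => ?_)
    (Metric.isOpen_ball.mem_nhds (by simpa using hyρ))
  rw [norm_mul, norm_pow, RCLike.norm_ofReal]
  have hz' : ‖z‖ ≤ ρ := by simpa using (Metric.mem_ball.1 hz).le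
  exact mul_le_mul (hg n) (pow_le_pow_left₀ (norm_nonneg _) hz' n) (by positivity)
    ((abs_nonneg _).trans (hg n))

/-- The recursion compares coefficients in a product with `α y + γ`. Two uses, with the recursions
of the two state coordinates, extract the double zero. -/
theorem tsum_eq_linear_mul_tsum {g c : ℕ → ℝ} {M α γ : ℝ} (hg : ∀ n, |g n| ≤ M)
    (h0 : c 0 = γ * g 0) (hc : ∀ n, c (n + 1) = α * g n + γ * g (n + 1)) {y : 𝕜} (hy : ‖y‖ < 1) :
    ∑' n, (c n : 𝕜) * y ^ n = (α * y + γ) * ∑' n, (g n : 𝕜) * y ^ n := by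
  have hs := summable_bounded_mul_pow hg hy
  have hs1 := (summable_nat_add_iff (f := fun n => (g n : 𝕜) * y ^ n) 1).2 hs
  have hc1 : HasSum (fun n => (c (n + 1) : 𝕜) * y ^ (n + 1))
      (α * y * (∑' n, (g n : 𝕜) * y ^ n) + γ * ∑' n, (g (n + 1) : 𝕜) * y ^ (n + 1)) := by
    have h := (hs.hasSum.mul_left ((α : 𝕜) * y)).add (hs1.hasSum.mul_left (γ : 𝕜))
    have e : (fun n => (c (n + 1) : 𝕜) * y ^ (n + 1)) = fun n =>
        (α : 𝕜) * y * ((g n : 𝕜) * y ^ n) + γ * ((g (n + 1) : 𝕜) * y ^ (n + 1)) := by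
      funext n; rw [hc]; push_cast; ring
    rwa [e]
  have hc0 : Summable fun n => (c n : 𝕜) * y ^ n :=
    (summable_nat_add_iff (f := fun n => (c n : 𝕜) * y ^ n) 1).1 hc1.summable
  have e1 := hc0.tsum_eq_zero_add
  have e2 := hs.tsum_eq_zero_add
  rw [hc1.tsum_eq, h0, RCLike.ofReal_mul] at e1
  rw [e1]
  linear_combination (-(γ : 𝕜)) * e2

theorem seriesSum_eq_tsum_ofReal (a : ℕ → ℤ) (y : 𝕜) :
    seriesSum a y = ∑' n, (((a n : ℤ) : ℝ) : 𝕜) * y ^ n := by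
  simp [seriesSum]

theorem seriesSum_update {a : ℕ → ℤ} (ha : ∀ n, |a n| ≤ 1) (n : ℕ) (d : ℤ) {y : 𝕜}
    (hy : ‖y‖ < 1) :
    seriesSum (Function.update a n (a n + d)) y = seriesSum a y + d * y ^ n := by
  have hs := summable_bounded_mul_pow (𝕜 := 𝕜) (g := fun n => (a n : ℝ)) (M := 1)
    (fun n => by exact_mod_cast ha n) hy
  simp only [RCLike.ofReal_intCast] at hs
  have hsingle : HasSum (fun m => if m = n then (d : 𝕜) * y ^ n else 0) ((d : 𝕜) * y ^ n) :=
    hasSum_ite_eq n _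
  have h := (hs.hasSum.add hsingle).tsum_eq
  simp only [seriesSum]
  rw [← h]
  refine tsum_congr fun m => ?_
  by_cases hm : m = n
  · subst hm; simp [add_mul]
  · simp [hm]

theorem update_mem_classB {a : ℕ → ℤ} (ha : a ∈ classB) {n : ℕ} (hn : 1 ≤ n) {d : ℤ}
    (hd : a n + d ∈ ({-1, 0, 1} : Set ℤ)) : Function.update a n (a n + d) ∈ classB := by
  refine ⟨by rw [Function.update_of_ne (by omega)]; exact ha.1, fun m hm => ?_⟩
  by_cases h : m = n
  · subst h; simpa using hd
  · rw [Function.update_of_ne h]; exact ha.2 m hm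

end PowerSeries

theorem differentiableOn_seriesSum {a : ℕ → ℤ} (ha : ∀ n, |a n| ≤ 1) {ρ : ℝ} (hρ0 : 0 ≤ ρ)
    (hρ : ρ < 1) : DifferentiableOn ℂ (fun z : ℂ => seriesSum a z) (Metric.ball 0 ρ) := by
  refine Complex.differentiableOn_tsum_of_summable_norm (summable_geometric_of_lt_one hρ0 hρ)
    (fun n => by fun_prop) Metric.isOpen_ball fun n z hz => ?_
  have hz' : ‖z‖ ≤ ρ := by simpa using (Metric.mem_ball.1 hz).le
  rw [norm_mul, norm_pow, ← one_mul (ρ ^ n)]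
  exact mul_le_mul (norm_intCast_le_one (ha n)) (pow_le_pow_left₀ (norm_nonneg _) hz' n)
    (by positivity) zero_le_one

/-! ### Splitting a double zero -/

/-- A series of `ℬ` with a double zero of positive second order coefficient, the remaining factor
having bounded coefficients `g`. -/
structure DoubleZero (x : ℝ) (a : ℕ → ℤ) (β M : ℝ) (g : ℕ → ℝ) : Prop where
  pos : 0 < x
  lt_one : x < 1
  mem : a ∈ classB
  scale_pos : 0 < β
  bounded : ∀ n, |g n| ≤ M
  cofactor_pos : 0 < ∑' n, g n * x ^ n
  fact_real : ∀ y : ℝ, ‖y‖ < 1 → seriesSum a y = β * (y - x) ^ 2 * ∑' n, g n * y ^ n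
  fact_complex : ∀ y : ℂ, ‖y‖ < 1 →
    seriesSum a y = β * (y - x) ^ 2 * ∑' n, (g n : ℂ) * y ^ n

namespace DoubleZero

variable {x : ℝ} {a : ℕ → ℤ} {β M : ℝ} {g : ℕ → ℝ}

/-- After adding `z ^ n` the series is positive at the reals near `x`, while a quantitative open
mapping theorem still forces a zero in the disc; that zero is nonreal. -/
theorem mem_closure_locusM (h : DoubleZero x a β M g) (hinf : ∀ N, ∃ n ≥ N, a n ≠ 1) :
    (x : ℂ) ∈ closure (locusM \ inComplex univ) := by
  obtain ⟨hx0, hx1, ha, hβ, hg, hR, -, hfac⟩ := h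
  have hab := abs_le_one_of_mem_classB ha
  set R := ∑' n, g n * x ^ n with hRdef
  set G : ℂ → ℂ := fun z => ∑' n, (g n : ℂ) * z ^ n with hG
  have hGx : G x = R := by simp [hG, hRdef, Complex.ofReal_tsum]
  have hnx : ‖(x : ℂ)‖ < 1 := by simpa [abs_of_pos hx0] using hx1
  rw [Metric.mem_closure_iff]
  intro ε hε
  obtain ⟨r₀, hr₀, hball⟩ := Metric.continuousAt_iff.1
    (continuousAt_tsum_bounded_mul_pow (𝕜 := ℂ) hg hnx) (R / 2) (by positivity)
  obtain ⟨r, hr, hrmin⟩ := exists_between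
    (show 0 < min (min ε r₀) (min (1 - x) x) from lt_min (lt_min hε hr₀)
      (lt_min (by linarith) hx0))
  obtain ⟨⟨hrε, hrr₀⟩, hr1, hrx⟩ : (r < ε ∧ r < r₀) ∧ r < 1 - x ∧ r < x := by
    simpa only [lt_min_iff] using hrmin
  have hclose : ∀ z : ℂ, ‖z - x‖ ≤ r → ‖G z - R‖ < R / 2 := by
    intro z hz
    rw [← hGx, ← dist_eq_norm]
    exact hball (by rw [dist_eq_norm]; linarith)
  have hnorm : ∀ z : ℂ, ‖z - x‖ ≤ r → ‖z‖ ≤ x + r := by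
    intro z hz
    have := norm_add_le (z - x) (x : ℂ)
    rw [sub_add_cancel, Complex.norm_real, Real.norm_of_nonneg hx0.le] at this
    linarith
  have hρ1 : x + r < 1 := by linarith
  set m := β * r ^ 2 * (R / 2) with hm
  have hmpos : 0 < m := by positivity
  obtain ⟨N, hN⟩ := exists_pow_lt_of_lt_one (show 0 < m / 4 by positivity) hρ1
  obtain ⟨n, hnN, hne⟩ := hinf (N + 1)
  have hn1 : 1 ≤ n := by omega
  have hpow : (x + r) ^ n < m / 4 :=
    (pow_le_pow_of_le_one (by positivity) hρ1.le (by omega)).trans_lt hN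
  set b := Function.update a n (a n + 1) with hb
  have hbB : b ∈ classB := by
    refine update_mem_classB ha hn1 ?_
    rcases ha.2 n hn1 with h | h | h
    · simp [h]
    · simp [h]
    · exact absurd h hne
  have hbf : ∀ z : ℂ, ‖z‖ < 1 → seriesSum b z = β * (z - x) ^ 2 * G z + z ^ n := by
    intro z hz
    rw [hb, seriesSum_update hab n 1 hz, hfac z hz]
    simp [hG]
  have hfx : seriesSum b (x : ℂ) = (x : ℂ) ^ n := by rw [hbf _ hnx]; simp
  have hxn : x ^ n < m / 4 := (pow_le_pow_left₀ hx0.le (by linarith) n).trans_lt hpow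
  obtain ⟨ρ, hρ, hρ1'⟩ := exists_between hρ1
  have hdiff : DiffContOnCl ℂ (fun z : ℂ => seriesSum b z) (Metric.ball (x : ℂ) r) := by
    refine DifferentiableOn.diffContOnCl
      ((differentiableOn_seriesSum (abs_le_one_of_mem_classB hbB) (by linarith) hρ1').mono ?_)
    rw [closure_ball _ hr.ne']
    intro z hz
    rw [mem_closedBall_iff_norm] at hz
    rw [mem_ball_zero_iff]
    exact (hnorm z hz).trans_lt hρ
  have hsphere : ∀ z ∈ Metric.sphere (x : ℂ) r,
      m / 2 ≤ ‖seriesSum b z - seriesSum b (x : ℂ)‖ := by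
    intro z hz
    rw [mem_sphere_iff_norm] at hz
    have hz1 : ‖z‖ ≤ x + r := hnorm z hz.le
    have hGz : R / 2 ≤ ‖G z‖ := by
      have h1 := norm_sub_norm_le (R : ℂ) (G z)
      rw [norm_sub_rev, Complex.norm_real, Real.norm_of_nonneg hR.le] at h1
      linarith [hclose z hz.le]
    have hmain : m ≤ ‖β * (z - x) ^ 2 * G z‖ := by
      rw [norm_mul, norm_mul, norm_pow, hz, Complex.norm_real, Real.norm_of_nonneg hβ.le]
      exact mul_le_mul_of_nonneg_left hGz (by positivity)
    have hzn : ‖z ^ n‖ < m / 4 := by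
      rw [norm_pow]
      exact (pow_le_pow_left₀ (norm_nonneg _) hz1 n).trans_lt hpow
    have hxn' : ‖(x : ℂ) ^ n‖ < m / 4 := by
      rwa [norm_pow, Complex.norm_real, Real.norm_of_nonneg hx0.le]
    rw [hfx, hbf z (hz1.trans_lt hρ1)]
    have h1 := norm_sub_le (β * (z - x) ^ 2 * G z + z ^ n - (x : ℂ) ^ n) (z ^ n - (x : ℂ) ^ n)
    have h2 := norm_sub_le (z ^ n) ((x : ℂ) ^ n)
    rw [show β * (z - x) ^ 2 * G z + z ^ n - (x : ℂ) ^ n - (z ^ n - (x : ℂ) ^ n) =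
      β * (z - x) ^ 2 * G z by ring] at h1
    linarith
  have hreal : ∀ y : ℝ, ‖(y : ℂ) - x‖ ≤ r → seriesSum b (y : ℂ) =
      ((β * (y - x) ^ 2 * (∑' n, g n * y ^ n) + y ^ n : ℝ) : ℂ) ∧ 0 < ∑' n, g n * y ^ n := by
    intro y hy
    have hGy : G y = ((∑' n, g n * y ^ n : ℝ) : ℂ) := by simp [hG, Complex.ofReal_tsum]
    refine ⟨?_, ?_⟩
    · rw [hbf _ ((hnorm _ hy).trans_lt hρ1), hGy]; push_cast; rfl
    · have h1 := hclose y hy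
      rw [hGy, ← Complex.ofReal_sub, Complex.norm_real, Real.norm_eq_abs, abs_lt] at h1
      linarith
  have hfreq : ∃ᶠ z in 𝓝 (x : ℂ), seriesSum b z ≠ seriesSum b (x : ℂ) := by
    have htend : Tendsto (fun y : ℝ => (y : ℂ)) (𝓝[>] x) (𝓝 (x : ℂ)) :=
      (Complex.continuous_ofReal.tendsto x).mono_left nhdsWithin_le_nhds
    refine htend.frequently (Eventually.frequently ?_)
    filter_upwards [Ioo_mem_nhdsGT (show x < x + r by linarith)] with y hy
    have hyr : ‖(y : ℂ) - x‖ ≤ r := by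
      rw [← Complex.ofReal_sub, Complex.norm_real, Real.norm_eq_abs, abs_le]
      constructor <;> linarith [hy.1, hy.2]
    obtain ⟨h1, h2⟩ := hreal y hyr
    rw [h1, hfx, ← Complex.ofReal_pow, Ne, Complex.ofReal_inj]
    have h3 : x ^ n < y ^ n := pow_lt_pow_left₀ hy.1 hx0.le (by omega)
    have h4 : 0 ≤ β * (y - x) ^ 2 * ∑' n, g n * y ^ n := by positivity
    linarith
  -- The lower bound `m / 2` on the circle puts the ball of radius `m / 4` about the central value
  -- `x ^ n` in the image, and `x ^ n < m / 4`.
  obtain ⟨z, hz, hz0⟩ := hdiff.ball_subset_image_closedBall hr hsphere hfreq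
    (show (0 : ℂ) ∈ _ by
      rw [mem_ball_iff_norm', hfx, sub_zero, norm_pow, Complex.norm_real,
        Real.norm_of_nonneg hx0.le]
      linarith)
  rw [mem_closedBall_iff_norm] at hz
  refine ⟨z, ⟨⟨(hnorm z hz).trans_lt hρ1, b, hbB, hz0⟩, ?_⟩, ?_⟩
  · rintro ⟨y, -, rfl⟩
    obtain ⟨h1, h2⟩ := hreal y hz
    have hy0 : 0 < y := by
      rw [← Complex.ofReal_sub, Complex.norm_real, Real.norm_eq_abs, abs_le] at hz
      linarith [hz.1]
    have h3 : 0 < β * (y - x) ^ 2 * (∑' n, g n * y ^ n) + y ^ n := by positivity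
    refine h3.ne' ?_
    simpa only [h1, Complex.ofReal_eq_zero] using hz0
  · rw [dist_comm, dist_eq_norm]
    exact hz.trans_lt hrε

/-- After subtracting `y ^ n` the series is negative at `x` but still positive at `x ± r`, so it has
a zero on each side of `x`. -/
theorem mem_closure_locusN (h : DoubleZero x a β M g) (hinf : ∀ N, ∃ n ≥ N, a n ≠ -1) :
    (x, x) ∈ closure (locusN \ Diag univ) := by
  obtain ⟨hx0, hx1, ha, hβ, hg, hR, hfac, -⟩ := h
  have hab := abs_le_one_of_mem_classB ha
  set R := ∑' n, g n * x ^ n with hRdef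
  have hnx : ‖x‖ < 1 := by simpa [abs_of_pos hx0] using hx1
  rw [Metric.mem_closure_iff]
  intro ε hε
  obtain ⟨r₀, hr₀, hball⟩ := Metric.continuousAt_iff.1
    (continuousAt_tsum_bounded_mul_pow (𝕜 := ℝ) hg hnx) (R / 2) (by positivity)
  obtain ⟨r, hr, hrmin⟩ := exists_between
    (show 0 < min (min ε r₀) (min (1 - x) x) from lt_min (lt_min hε hr₀)
      (lt_min (by linarith) hx0))
  obtain ⟨⟨hrε, hrr₀⟩, hr1, hrx⟩ : (r < ε ∧ r < r₀) ∧ r < 1 - x ∧ r < x := by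
    simpa only [lt_min_iff] using hrmin
  have hclose : ∀ y : ℝ, |y - x| ≤ r → R / 2 ≤ ∑' n, g n * y ^ n := by
    intro y hy
    have h1 := hball (x := y) (by rw [Real.dist_eq]; linarith)
    simp only [RCLike.ofReal_real_eq_id, id] at h1
    rw [Real.dist_eq, abs_lt] at h1
    linarith [h1.1]
  set m := β * r ^ 2 * (R / 2) with hm
  have hmpos : 0 < m := by positivity
  obtain ⟨N, hN⟩ := exists_pow_lt_of_lt_one hmpos (show x + r < 1 by linarith)
  obtain ⟨n, hnN, hne⟩ := hinf (N + 1)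
  have hn1 : 1 ≤ n := by omega
  have hpow : (x + r) ^ n < m :=
    (pow_le_pow_of_le_one (by positivity) (by linarith) (by omega)).trans_lt hN
  set b := Function.update a n (a n + -1) with hb
  have hbB : b ∈ classB := by
    refine update_mem_classB ha hn1 ?_
    rcases ha.2 n hn1 with h | h | h
    · exact absurd h hne
    · simp [h]
    · simp only [mem_singleton_iff] at h; simp [h]
  have hbf : ∀ y : ℝ, |y - x| ≤ r →
      seriesSum b y = β * (y - x) ^ 2 * (∑' n, g n * y ^ n) - y ^ n := by
    intro y hy
    have hy1 : ‖y‖ < 1 := by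
      rw [abs_le] at hy
      rw [Real.norm_eq_abs, abs_lt]
      constructor <;> linarith [hy.1, hy.2]
    rw [hb, seriesSum_update hab n (-1) hy1, hfac y hy1]
    push_cast; ring
  have hcont : ContinuousOn (fun y : ℝ => seriesSum b y) (Icc (x - r) (x + r)) := by
    intro y hy
    have hy1 : ‖y‖ < 1 := by
      rw [Real.norm_eq_abs, abs_lt]
      constructor <;> linarith [hy.1, hy.2]
    have := continuousAt_tsum_bounded_mul_pow (𝕜 := ℝ) (g := fun n => (b n : ℝ)) (M := 1)
      (fun n => by exact_mod_cast abs_le_one_of_mem_classB hbB n) hy1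
    simp only [RCLike.ofReal_real_eq_id, id] at this
    exact this.continuousWithinAt
  have hend : ∀ y : ℝ, |y - x| = r → 0 < seriesSum b y := by
    intro y hy
    rw [hbf y hy.le, ← sq_abs (y - x), hy]
    have h1 : m ≤ β * r ^ 2 * ∑' n, g n * y ^ n :=
      mul_le_mul_of_nonneg_left (hclose y hy.le) (by positivity)
    have h2 := abs_le.1 hy.le
    have h3 : y ^ n ≤ (x + r) ^ n := pow_le_pow_left₀ (by linarith [h2.1]) (by linarith [h2.2]) n
    linarith
  have hmid : seriesSum b x < 0 := by
    rw [hbf x (by simpa using hr.le)]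
    simpa using pow_pos hx0 n
  obtain ⟨y₁, hy₁, h₁⟩ := intermediate_value_Ioo' (show x - r ≤ x by linarith)
    (hcont.mono (Icc_subset_Icc le_rfl (by linarith)))
    ⟨hmid, hend (x - r) (by rw [sub_sub_cancel_left, abs_neg, abs_of_pos hr])⟩
  obtain ⟨y₂, hy₂, h₂⟩ := intermediate_value_Ioo (show x ≤ x + r by linarith)
    (hcont.mono (Icc_subset_Icc (by linarith) le_rfl))
    ⟨hmid, hend (x + r) (by rw [add_sub_cancel_left, abs_of_pos hr])⟩
  refine ⟨(y₁, y₂), ⟨⟨⟨by linarith [hy₁.1], by linarith [hy₁.2]⟩,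
    ⟨by linarith [hy₂.1], by linarith [hy₂.2]⟩, b, hbB, h₁, h₂⟩, ?_⟩, ?_⟩
  · rintro ⟨y, -, hy⟩
    rw [Prod.mk.injEq] at hy
    linarith [hy₁.2, hy₂.1, hy.1, hy.2]
  · rw [Prod.dist_eq, max_lt_iff]
    simp only [Real.dist_eq, abs_lt]
    refine ⟨⟨?_, ?_⟩, ?_, ?_⟩ <;> linarith [hy₁.1, hy₁.2, hy₂.1, hy₂.2]

end DoubleZero

/-! ### The series with a double zero at `4188 / 6265` -/

theorem not_bounded_of_expanding {β M : ℝ} (hβ : 1 < β) {t : ℕ → ℝ} (h0 : 0 < t 0)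
    (ht : ∀ n, t (n + 1) = β * t n) : ∃ n, M < t n := by
  have hpow : ∀ n, t n = β ^ n * t 0 := by
    intro n
    induction n with
    | zero => simp
    | succ n ih => rw [ht, ih]; ring
  obtain ⟨n, hn⟩ := pow_unbounded_of_one_lt (M / t 0) hβ
  refine ⟨n, ?_⟩
  rw [hpow]
  exact (div_lt_iff₀ h0).1 hn

/-- The digits of a bounded orbit are not eventually `1` and not eventually `-1`. -/
theorem IsOrbit.exists_ne {q : ℕ → ℝ × ℝ} {c : ℕ → ℤ} (h : IsOrbit q c) {e : ℤ} (he : |e| = 1)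
    (N : ℕ) : ∃ n ≥ N, c n ≠ e := by
  by_contra! hc
  have he2 : (e : ℝ) * e = 1 := by
    have : e * e = 1 := by rw [← abs_mul_abs_self, he, one_mul]
    exact_mod_cast this
  have hbd : ∀ n, |(e : ℝ) * (q n).1| < 6265 / 2077 := by
    intro n
    rw [abs_mul, ← Int.cast_abs, he, Int.cast_one, one_mul]
    exact (h n).2.2.1
  -- With constant digit `e` the first coordinate moves by `u ↦ β (u - e)`, which expands away from
  -- its fixed point `e * (6265 / 2077)`; the strict bound keeps the orbit off that point.
  obtain ⟨n, hn⟩ := not_bounded_of_expanding (β := 6265 / 4188) (M := 2 * (6265 / 2077))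
    (by norm_num) (t := fun n => 6265 / 2077 - e * (q (N + n)).1)
    (by linarith [(abs_lt.1 (hbd (N + 0))).2]) (fun n => by
      rw [← add_assoc, (h (N + n)).2.1, hc (N + n) (by omega)]
      simp only [shiftState]
      linear_combination (6265 / 4188 : ℝ) * he2)
  linarith [(abs_lt.1 (hbd (N + n))).1]

/-- A series of `ℬ` with a double zero at `4188/6265`, neither eventually `1` nor eventually `-1`. -/
theorem exists_doubleZero : ∃ a β M g, DoubleZero (4188 / 6265) a β M g ∧
    (∀ N, ∃ n ≥ N, a n ≠ 1) ∧ ∀ N, ∃ n ≥ N, a n ≠ -1 := by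
  obtain ⟨q, c, hq, h0, hpos⟩ := exists_orbit_pos
  let a : ℕ → ℤ := fun n => Nat.casesOn n 1 c
  have hrec : ∀ n, q (n + 1) = shiftState (6265 / 4188) (c n) (q n) := fun n => (hq n).2.1
  have hfst : ∀ n, |(q n).1| ≤ 6265 / 2077 := fun n => (hq n).2.2.1.le
  have hsnd : ∀ n, |(q n).2| ≤ 6.4 := fun n => (hq n).2.2.2
  -- With states `(u, w)`, the series equals `(y - x) ∑ u n * y ^ n`, and `∑ u n * y ^ n = (β y - 1)
  -- ∑ w n * y ^ n`.
  have fact : ∀ {𝕜 : Type} [RCLike 𝕜] (y : 𝕜), ‖y‖ < 1 → seriesSum a y =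
      ((6265 / 4188 : ℝ) : 𝕜) * (y - ((4188 / 6265 : ℝ) : 𝕜)) ^ 2 *
        ∑' n, ((q n).2 : 𝕜) * y ^ n := by
    intro 𝕜 _ y hy
    rw [seriesSum_eq_tsum_ofReal,
      tsum_eq_linear_mul_tsum (g := fun n => (q n).1) (α := 1) (γ := -(4188 / 6265)) hfst ?_ ?_ hy,
      tsum_eq_linear_mul_tsum (g := fun n => (q n).2) (α := 6265 / 4188) (γ := -1) hsnd ?_ ?_ hy]
    · have e : ((6265 / 4188 : ℝ) : 𝕜) * ((4188 / 6265 : ℝ) : 𝕜) = 1 := by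
        rw [← RCLike.ofReal_mul]; norm_num
      simp only [RCLike.ofReal_neg, RCLike.ofReal_one]
      linear_combination (y - ((4188 / 6265 : ℝ) : 𝕜)) *
        (∑' n, ((q n).2 : 𝕜) * y ^ n) * e
    · simp only [h0]; norm_num
    · intro n
      simp only [hrec, shiftState]
      ring
    · simp only [h0, a]; norm_num
    · intro n
      simp only [hrec, shiftState, a]
      ring
  have hshift : ∀ e : ℤ, |e| = 1 → ∀ N, ∃ n ≥ N, a n ≠ e := by
    intro e he N
    obtain ⟨n, hn, hne⟩ := hq.exists_ne he N
    exact ⟨n + 1, by omega, hne⟩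
  refine ⟨a, 6265 / 4188, 6.4, fun n => (q n).2, ⟨by norm_num, by norm_num, ⟨rfl, ?_⟩,
    by norm_num, hsnd, hpos, ?_, ?_⟩, hshift 1 rfl, hshift (-1) rfl⟩
  · rintro (_ | n) hn
    · omega
    · have := abs_le.1 (hq n).1
      have h3 : c n = -1 ∨ c n = 0 ∨ c n = 1 := by omega
      simpa [a] using h3
  · intro y hy
    simpa using fact y hy
  · intro y hy
    simpa using fact y hy

/-! ### Location of the tips -/

theorem notMem_closure_locusM {x : ℝ} (hx : x ∈ Icc (1 / 2) 0.668475505) :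
    (x : ℂ) ∉ closure (locusM \ inComplex univ) := by
  intro hmem
  obtain ⟨a, ha, h1, h2⟩ := exists_double_zero_of_pairs (𝕜 := ℂ) (x := x) (by linarith [hx.1])
    (by linarith [hx.2]) fun ε hε => by
      obtain ⟨z, ⟨⟨hz1, a, ha, hz⟩, hreal⟩, hd⟩ := Metric.mem_closure_iff.1 hmem ε hε
      rw [dist_comm, dist_eq_norm] at hd
      -- Real coefficients make the conjugate a second zero, distinct because `z` is nonreal and
      -- equally close to the real point `x`.
      refine ⟨z, (starRingEnd ℂ) z, ?_, hd, ?_, a, ha, hz, ?_⟩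
      · intro h
        exact hreal ⟨z.re, mem_univ _, Complex.conj_eq_iff_re.1 h.symm⟩
      · have : (starRingEnd ℂ) z - ((x : ℝ) : ℂ) = (starRingEnd ℂ) (z - x) := by simp
        rw [show ((RCLike.ofReal x : ℂ)) = (x : ℂ) from rfl, this, RCLike.norm_conj]
        exact hd
      · have : seriesSum a ((starRingEnd ℂ) z) = (starRingEnd ℂ) (seriesSum a z) := by
          simp [seriesSum, Complex.conj_tsum]
        rw [this, hz, map_zero]
  exact no_double_zero hx ha h1 h2

theorem notMem_closure_locusN {x : ℝ} (hx : x ∈ Icc (1 / 2) 0.668475505) :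
    (x, x) ∉ closure (locusN \ Diag univ) := by
  intro hmem
  obtain ⟨a, ha, h1, h2⟩ := exists_double_zero_of_pairs (𝕜 := ℝ) (x := x) (by linarith [hx.1])
    (by linarith [hx.2]) fun ε hε => by
      obtain ⟨⟨y₁, y₂⟩, ⟨⟨-, -, a, ha, hz1, hz2⟩, hdiag⟩, hd⟩ :=
        Metric.mem_closure_iff.1 hmem ε hε
      rw [dist_comm, Prod.dist_eq, max_lt_iff] at hd
      refine ⟨y₁, y₂, ?_, hd.1, hd.2, a, ha, hz1, hz2⟩
      rintro rfl
      exact hdiag ⟨y₁, mem_univ _, rfl⟩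
  exact no_double_zero hx ha h1 h2

end ConnLoci

theorem corollary2p7 :
    (∃ s ∈ Set.Ioo (0.6684755 : ℝ) 0.6684757,
      IsLUB {x : ℝ | (x : ℂ) ∈ ConnLoci.antennaM} s) ∧
    (∃ t ∈ Set.Ioo (0.6684755 : ℝ) 0.6684757,
      IsLUB {x : ℝ | (x, x) ∈ ConnLoci.antennaN} t) := by
  obtain ⟨a, β, M, g, hz, hne1, hne2⟩ := ConnLoci.exists_doubleZero
  have hsub : ∀ s ∈ Set.Icc (0.668475505 : ℝ) (4188 / 6265),
      s ∈ Set.Ioo (0.6684755 : ℝ) 0.6684757 := fun s hs =>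
    ⟨lt_of_lt_of_le (by norm_num) hs.1, lt_of_le_of_lt hs.2 (by norm_num)⟩
  constructor
  · obtain ⟨s, hs, hlub⟩ := ConnLoci.exists_isLUB_component Complex.continuous_ofReal
      Complex.continuous_re Complex.ofReal_re (α := 0.668475505) (by norm_num) (by norm_num)
      (fun x hx => ConnLoci.notMem_closure_locusM hx) (hz.mem_closure_locusM hne1) (by norm_num)
    refine ⟨s, hsub s hs, ?_⟩
    simpa [ConnLoci.antennaM, ConnLoci.inComplex] using hlub
  · obtain ⟨s, hs, hlub⟩ := ConnLoci.exists_isLUB_component (ι := fun x : ℝ => (x, x))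
      (by fun_prop) continuous_fst (fun _ => rfl) (α := 0.668475505) (by norm_num) (by norm_num)
      (fun x hx => ConnLoci.notMem_closure_locusN hx) (hz.mem_closure_locusN hne2) (by norm_num)
    exact ⟨s, hsub s hs, hlub⟩
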